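/- Let $\mathbb{F}=\mathbb{C}(q)$, $d=q+q^{-1}$ and $[n]=\frac{q^n-q^{-n}}{q-q^{-1}}$. The generic Temperley-Lieb category $\mathrm{TL}$ has as objects the integers $n\ge 0$; $\mathrm{Hom}(m,n)$ is the $\mathbb{F}$-vector space with basis the loopless planar diagrams (non-crossing perfect matchings, up to planar isotopy) connecting $m$ points on the bottom edge and $n$ points on the top edge of a square; composition is the bilinear extension of vertical stacking, where every closed loop is replaced by the factor $d$. Let $\otimes$ denote the bilinear extension of horizontal juxtaposition, let $\cup\colon 0\to 2$ and $\cap\colon 2\to 0$ be the diagrams with a single arc, and define $p_n\in\mathrm{Hom}(n,n)$ by $p_0=\mathrm{id}_0$, $p_1=\mathrm{id}_1$ and, for $n\ge 1$, $$p_{n+1}=p_n\otimes \mathrm{id}_1-\frac{[n]}{[n+1]}\,(p_n\otimes \mathrm{id}_1)\circ\bigl(\mathrm{id}_{n-1}\otimes(\cup\circ\cap)\bigr)\circ(p_n\otimes \mathrm{id}_1).$$ Then every $p_n$ is idempotent, so that the $p_n$ (the Jones-Wenzl idempotents) are objects of the Karoubi envelope $\mathcal{K}ar\,\mathrm{TL}$;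 they are pairwise distinct, and they form a collection of disjoint simple objects of the $\mathbb{F}$-linear category $\mathcal{K}ar\,\mathrm{TL}$. That is, $\mathrm{Hom}(p_n,p_n)=\mathrm{span}_{\mathbb{F}}\{\mathbb{1}_{p_n}\}$ for all $n\ge 0$, and $\mathrm{Hom}(p_m,p_n)=\{0\}$ for all $m\neq n$. -/

import Mathlib

open CategoryTheory CategoryTheory.Idempotents

namespace TemperleyLieb


/-- Stacking of connection relations: the equivalence relation on bottom, middle and top points
generated by the arcs of the lower picture `r` and of the upper picture `s`. -/
def glue {A B C : Type} (r : Setoid (A ⊕ B)) (s : Setoid (B ⊕ C)) : Setoid (A ⊕ B ⊕ C) :=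
  r.map (Sum.map id Sum.inl) ⊔ s.map Sum.inr

/-- The classes of an equivalence relation that contain no point satisfying `D`. -/
def Avoiding {Z : Type} (S : Setoid Z) (D : Z → Prop) : Type :=
  {c : Quotient S // ∀ z, D z → Quotient.mk S z ≠ c}

/-- The points of the bottom and the top line, among bottom, middle and top points. -/
def IsOuter {A B C : Type} : A ⊕ B ⊕ C → Prop
  | .inl _ => True
  | .inr (.inl _) => False
  | .inr (.inr _) => True

/-- The number of closed components that arise by stacking. -/
noncomputable def loopCount {A B C : Type} (r : Setoid (A ⊕ B)) (s : Setoid (B ⊕ C)) : ℕ :=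
  Nat.card (Avoiding (glue r s) IsOuter)

/-- The connection relation on the bottom and top points of a stacked picture. -/
def stack {A B C : Type} (r : Setoid (A ⊕ B)) (s : Setoid (B ⊕ C)) : Setoid (A ⊕ C) :=
  (glue r s).comap (Sum.map id Sum.inr)

theorem map_le_iff {X Z : Type} (r : Setoid X) (f : X → Z) (u : Setoid Z) :
    r.map f ≤ u ↔ r ≤ u.comap f := by
  constructor
  · intro h
    exact Setoid.le_comap_map.trans (fun x y hxy => h hxy)
  · intro h
    refine Setoid.eqvGen_le ?_
    rintro _ _ ⟨a, b, hab, rfl, rfl⟩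
    exact h hab

theorem glue_le_iff {A B C : Type} (r : Setoid (A ⊕ B)) (s : Setoid (B ⊕ C))
    (u : Setoid (A ⊕ B ⊕ C)) :
    glue r s ≤ u ↔ r ≤ u.comap (Sum.map id Sum.inl) ∧ s ≤ u.comap Sum.inr := by
  simp only [glue, sup_le_iff, map_le_iff]

/-- Contracting a subpicture `g`: `Z` is obtained by gluing `X` and `W` along `Y`. -/
theorem contract {X Y W Z : Type} (e : Y → X) (k : Y → W) (α : X → Z) (β : W → Z)
    (hk : ∀ y, α (e y) = β (k y)) (hα : α.Injective) (hβ : β.Injective)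
    (hpo : ∀ x w, α x = β w → ∃ y, x = e y ∧ w = k y)
    (hcov : ∀ z, (∃ w, z = β w) ∨ ∃ x, (∀ y, x ≠ e y) ∧ z = α x)
    (g : Setoid X) (t : Setoid W) (D : W → Prop) :
    (g.map α ⊔ t.map β).comap β = (g.comap e).map k ⊔ t ∧
    Nonempty (Avoiding (g.map α ⊔ t.map β) (fun z => ∃ w, z = β w ∧ D w) ≃
      Avoiding ((g.comap e).map k ⊔ t) D ⊕ Avoiding g (fun x => ∃ y, x = e y)) := by
  classical
  set S := g.map α ⊔ t.map β with hS
  set T := (g.comap e).map k ⊔ t with hT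
  have hgS : ∀ x x', g x x' → S (α x) (α x') := fun x x' h =>
    (le_sup_left : g.map α ≤ S) (Setoid.le_comap_map h)
  have htS : ∀ w w', t w w' → S (β w) (β w') := fun x x' h =>
    (le_sup_right : t.map β ≤ S) (Setoid.le_comap_map h)
  have hTS : T ≤ S.comap β := by
    refine sup_le ?_ (fun w w' h => htS w w' h)
    rw [map_le_iff]
    intro y y' h
    change S (β (k y)) (β (k y'))
    rw [← hk, ← hk]
    exact hgS _ _ h
  have hgT : ∀ y y', g (e y) (e y') → T (k y) (k y') := fun y y' h =>
    (le_sup_left : (g.comap e).map k ≤ T) (Setoid.le_comap_map h)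
  have htT : ∀ w w', t w w' → T w w' := fun w w' h => (le_sup_right : t ≤ T) h
  -- the class of a point of `X`
  let R := Quotient T ⊕ Avoiding g (fun x => ∃ y, x = e y)
  let FX : X → R := fun x =>
    if h : ∃ y, g x (e y) then .inl (Quotient.mk T (k h.choose))
    else .inr ⟨Quotient.mk g x, by
      rintro _ ⟨y, rfl⟩ hy
      exact h ⟨y, g.symm (Quotient.exact hy)⟩⟩
  have FX_pos : ∀ x y, g x (e y) → FX x = .inl (Quotient.mk T (k y)) := by
    intro x y h
    have h' : ∃ y, g x (e y) := ⟨y, h⟩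
    simp only [FX, dif_pos h']
    congr 1
    exact Quotient.sound (hgT _ _ (g.trans (g.symm h'.choose_spec) h))
  have FX_neg : ∀ x (h : ¬ ∃ y, g x (e y)), ∃ p, FX x = .inr ⟨Quotient.mk g x, p⟩ := by
    intro x h
    exact ⟨_, dif_neg h⟩
  have FX_resp : ∀ x x', g x x' → FX x = FX x' := by
    intro x x' h
    by_cases hx : ∃ y, g x' (e y)
    · obtain ⟨y, hy⟩ := hx
      rw [FX_pos x' y hy, FX_pos x y (g.trans h hy)]
    · have hx' : ¬ ∃ y, g x (e y) := fun ⟨y, hy⟩ => hx ⟨y, g.trans (g.symm h) hy⟩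
      obtain ⟨p, hp⟩ := FX_neg x' hx
      obtain ⟨p', hp'⟩ := FX_neg x hx'
      rw [hp, hp']
      congr 2
      exact Quotient.sound h
  let F : Z → R := fun z =>
    if h : ∃ w, z = β w then .inl (Quotient.mk T h.choose)
    else if h' : ∃ x, z = α x then FX h'.choose
    else FX ((hcov z).resolve_left h).choose
  have F_β : ∀ w, F (β w) = .inl (Quotient.mk T w) := by
    intro w
    have h : ∃ w', β w = β w' := ⟨w, rfl⟩
    simp only [F, dif_pos h]
    rw [hβ h.choose_spec.symm]
  have F_α : ∀ x, F (α x) = FX x := by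
    intro x
    by_cases h : ∃ w, α x = β w
    · obtain ⟨w, hw⟩ := h
      obtain ⟨y, rfl, rfl⟩ := hpo x w hw
      rw [hw, F_β, FX_pos _ y (g.refl _)]
    · have h' : ∃ x', α x = α x' := ⟨x, rfl⟩
      simp only [F, dif_neg h, dif_pos h']
      rw [hα h'.choose_spec.symm]
  have hSF : S ≤ Setoid.ker F := by
    refine sup_le ?_ ?_
    · rw [map_le_iff]
      intro x x' h
      change F (α x) = F (α x')
      rw [F_α, F_α]; exact FX_resp _ _ h
    · rw [map_le_iff]
      intro x x' h
      change F (β x) = F (β x')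
      rw [F_β, F_β, Quotient.sound (htT _ _ h)]
  -- every point is `S`-related to its normal form
  have hnf : ∀ z, (∃ w, S z (β w)) ∨
      ∃ x, S z (α x) ∧ ¬ ∃ y, g x (e y) := by
    intro z
    rcases hcov z with ⟨w, rfl⟩ | ⟨x, -, rfl⟩
    · exact .inl ⟨w, S.refl _⟩
    · by_cases h : ∃ y, g x (e y)
      · obtain ⟨y, hy⟩ := h
        exact .inl ⟨k y, by rw [← hk]; exact hgS _ _ hy⟩
      · exact .inr ⟨x, S.refl _, h⟩
  have hFS : ∀ z z', F z = F z' → S z z' := by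
    intro z z' h
    rcases hnf z with ⟨w, hw⟩ | ⟨x, hx, hn⟩ <;> rcases hnf z' with ⟨w', hw'⟩ | ⟨x', hx', hn'⟩
    · rw [hSF hw, hSF hw', F_β, F_β] at h
      exact S.trans hw (S.trans (hTS (Quotient.exact (Sum.inl.inj h))) (S.symm hw'))
    · obtain ⟨p, hp⟩ := FX_neg x' hn'
      rw [hSF hw, hSF hx', F_β, F_α, hp] at h
      cases h
    · obtain ⟨p, hp⟩ := FX_neg x hn
      rw [hSF hx, hSF hw', F_β, F_α, hp] at h
      cases h
    · obtain ⟨p, hp⟩ := FX_neg x hn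
      obtain ⟨p', hp'⟩ := FX_neg x' hn'
      rw [hSF hx, hSF hx', F_α, F_α, hp, hp'] at h
      have := Quotient.exact (congrArg Subtype.val (Sum.inr.inj h))
      exact S.trans hx (S.trans (hgS _ _ this) (S.symm hx'))
  refine ⟨le_antisymm ?_ hTS, ⟨?_⟩⟩
  · intro w w' h
    have := hSF h
    change F (β w) = F (β w') at this
    rw [F_β, F_β] at this
    exact Quotient.exact (Sum.inl.inj this)
  · let Fq : Quotient S → R := Quotient.lift F (fun a b h => hSF h)
    have Fq_inj : Function.Injective Fq := by
      intro a b
      induction a using Quotient.inductionOn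
      induction b using Quotient.inductionOn
      intro h
      exact Quotient.sound (hFS _ _ h)
    have Fq_surj : Function.Surjective Fq := by
      rintro (c | ⟨c, hc⟩)
      · induction c using Quotient.inductionOn with
        | _ w => exact ⟨Quotient.mk S (β w), F_β w⟩
      · induction c using Quotient.inductionOn with
        | _ x =>
          have hn : ¬ ∃ y, g x (e y) := fun ⟨y, hy⟩ =>
            hc (e y) ⟨y, rfl⟩ (Quotient.sound (g.symm hy))
          obtain ⟨p, hp⟩ := FX_neg x hn
          exact ⟨Quotient.mk S (α x), (F_α x).trans hp⟩
    let P : R → Prop := Sum.elim (fun c => ∀ w, D w → Quotient.mk T w ≠ c) (fun _ => True)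
    have e1 : Avoiding S (fun z => ∃ w, z = β w ∧ D w) ≃ {x : R // P x} := by
      refine (Equiv.ofBijective Fq ⟨Fq_inj, Fq_surj⟩).subtypeEquiv ?_
      intro c
      change (∀ z, (∃ w, z = β w ∧ D w) → _) ↔ P (Fq c)
      constructor
      · intro h
        rcases hc : Fq c with q | q
        · intro w hw hq
          refine h (β w) ⟨w, rfl, hw⟩ (Fq_inj ?_)
          rw [hc, ← hq]
          exact F_β w
        · trivial
      · rintro h _ ⟨w, rfl, hw⟩ rfl
        have : P (F (β w)) := h
        rw [F_β] at this
        exact this w hw rfl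
    refine e1.trans (Equiv.subtypeSum.trans (Equiv.sumCongr (Equiv.refl _) ?_))
    exact Equiv.subtypeUnivEquiv (fun _ => trivial)

section assoc

variable {A B C D : Type} (r : Setoid (A ⊕ B)) (s : Setoid (B ⊕ C)) (t : Setoid (C ⊕ D))

/-- The relation on all four lines of points of a triple stack. -/
def glue₃ : Setoid (A ⊕ B ⊕ C ⊕ D) :=
  r.map (Sum.map id Sum.inl) ⊔ s.map (fun x => Sum.inr (Sum.map id Sum.inl x)) ⊔
    t.map (fun x => Sum.inr (Sum.inr x))

def IsOuter₃ : A ⊕ B ⊕ C ⊕ D → Prop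
  | .inl _ => True
  | .inr (.inr (.inr _)) => True
  | _ => False

theorem map_map' {X Y Z : Type} (r : Setoid X) (f : X → Y) (h : Y → Z) :
    (r.map f).map h = r.map (fun x => h (f x)) := by
  refine eq_of_forall_ge_iff fun u => ?_
  simp only [map_le_iff]; rfl

theorem map_sup' {X Y : Type} (r s : Setoid X) (f : X → Y) :
    (r ⊔ s).map f = r.map f ⊔ s.map f := by
  refine eq_of_forall_ge_iff fun u => ?_
  simp only [map_le_iff, sup_le_iff]

theorem triple_left :
    (glue₃ r s t).comap (Sum.map id Sum.inr) = glue (stack r s) t ∧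
    Nonempty (Avoiding (glue₃ r s t) IsOuter₃ ≃
      Avoiding (glue (stack r s) t) IsOuter ⊕ Avoiding (glue r s) IsOuter) := by
  have key := contract (X := A ⊕ B ⊕ C) (Y := A ⊕ C) (W := A ⊕ C ⊕ D) (Z := A ⊕ B ⊕ C ⊕ D)
    (Sum.map id Sum.inr) (Sum.map id Sum.inl)
    (Sum.map id (Sum.map id Sum.inl)) (Sum.map id Sum.inr)
    (by rintro (a | c) <;> rfl)
    (by rintro (a | b | c) (a' | b' | c') h <;> simp_all)
    (by rintro (a | c | d) (a' | c' | d') h <;> simp_all)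
    (by rintro (a | b | c) (a' | c' | d') h <;> simp_all)
    (by rintro (a | b | c | d) <;> simp)
    (glue r s) (t.map Sum.inr) IsOuter
  have h1 : (glue r s).map (Sum.map id (Sum.map id Sum.inl)) ⊔
      (t.map Sum.inr).map (Sum.map id Sum.inr) = glue₃ r s t := by
    simp only [glue, glue₃, map_sup', map_map']
    congr 2
    congr 1
    funext x; rcases x with a | b <;> rfl
  have h2 : ((glue r s).comap (Sum.map id Sum.inr)).map (Sum.map id Sum.inl) ⊔ t.map Sum.inr
      = glue (stack r s) t := rfl
  have h3 : (fun z : A ⊕ B ⊕ C ⊕ D => ∃ w, z = Sum.map id Sum.inr w ∧ IsOuter w) = IsOuter₃ := by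
    funext z
    rcases z with a | b | c | d <;> simp [IsOuter₃, IsOuter]
  have h4 : (fun x : A ⊕ B ⊕ C => ∃ y, x = Sum.map id Sum.inr y) = IsOuter := by
    funext z
    rcases z with a | b | c <;> simp [IsOuter]
  rw [h1, h2, h3, h4] at key
  exact key

theorem triple_right :
    (glue₃ r s t).comap (Sum.map id (Sum.map id Sum.inr)) = glue r (stack s t) ∧
    Nonempty (Avoiding (glue₃ r s t) IsOuter₃ ≃
      Avoiding (glue r (stack s t)) IsOuter ⊕ Avoiding (glue s t) IsOuter) := by
  have key := contract (X := B ⊕ C ⊕ D) (Y := B ⊕ D) (W := A ⊕ B ⊕ D) (Z := A ⊕ B ⊕ C ⊕ D)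
    (Sum.map id Sum.inr) Sum.inr Sum.inr (Sum.map id (Sum.map id Sum.inr))
    (by rintro (a | c) <;> rfl)
    (by rintro (a | b | c) (a' | b' | c') h <;> simp_all)
    (by rintro (a | c | d) (a' | c' | d') h <;> simp_all)
    (by rintro (a | b | c) (a' | c' | d') h <;> simp_all)
    (by rintro (a | b | c | d) <;> simp)
    (glue s t) (r.map (Sum.map id Sum.inl)) IsOuter
  have h1 : (glue s t).map (Sum.inr : _ → A ⊕ B ⊕ C ⊕ D) ⊔
      (r.map (Sum.map id Sum.inl)).map (Sum.map id (Sum.map id Sum.inr)) = glue₃ r s t := by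
    simp only [glue, glue₃, map_sup', map_map']
    rw [sup_comm, ← sup_assoc]
    congr 3
    funext x; rcases x with a | b <;> rfl
  have h2 : ((glue s t).comap (Sum.map id Sum.inr)).map Sum.inr ⊔ r.map (Sum.map id Sum.inl)
      = glue r (stack s t) := sup_comm _ _
  have h3 : (fun z : A ⊕ B ⊕ C ⊕ D =>
      ∃ w, z = Sum.map id (Sum.map id Sum.inr) w ∧ IsOuter w) = IsOuter₃ := by
    funext z
    rcases z with a | b | c | d <;> simp [IsOuter₃, IsOuter]
  have h4 : (fun x : B ⊕ C ⊕ D => ∃ y, x = Sum.map id Sum.inr y) = IsOuter := by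
    funext z
    rcases z with a | b | c <;> simp [IsOuter]
  rw [h1, h2, h3, h4] at key
  exact key

theorem stack_assoc : stack (stack r s) t = stack r (stack s t) := by
  have h1 : stack (stack r s) t = (glue₃ r s t).comap
      (fun x => Sum.map id Sum.inr (Sum.map id Sum.inr x)) := by
    rw [stack, ← (triple_left r s t).1]; rfl
  have h2 : stack r (stack s t) = (glue₃ r s t).comap
      (fun x => Sum.map id (Sum.map id Sum.inr) (Sum.map id Sum.inr x)) := by
    rw [stack, ← (triple_right r s t).1]; rfl
  rw [h1, h2]
  congr 1
  funext x; rcases x with a | d <;> rfl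

theorem loopCount_assoc [Finite A] [Finite B] [Finite C] [Finite D] :
    loopCount r s + loopCount (stack r s) t = loopCount s t + loopCount r (stack s t) := by
  have fin : ∀ {Z : Type} [Finite Z] (S : Setoid Z) (P : Z → Prop), Finite (Avoiding S P) :=
    fun S P => inferInstanceAs (Finite {c : Quotient S // _})
  have := fin (glue r s) IsOuter
  have := fin (glue s t) IsOuter
  have := fin (glue (stack r s) t) IsOuter
  have := fin (glue r (stack s t)) IsOuter
  obtain ⟨e⟩ := (triple_left r s t).2
  obtain ⟨e'⟩ := (triple_right r s t).2
  have h := Nat.card_congr (e.symm.trans e')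
  rw [Nat.card_sum, Nat.card_sum] at h
  unfold loopCount
  omega

end assoc

/-- Vertical strings. -/
def through (A : Type) : Setoid (A ⊕ A) := Setoid.ker (Sum.elim id id)

theorem stack_through_left {A B : Type} (r : Setoid (A ⊕ B)) :
    stack (through A) r = r ∧ loopCount (through A) r = 0 := by
  have hg : glue (through A) r = r.comap (Sum.elim Sum.inl id) := by
    refine le_antisymm ?_ ?_
    · rw [glue_le_iff]
      refine ⟨?_, fun _ _ h => h⟩
      rintro (a | a) (b | b) h <;>
      · obtain rfl : a = b := h
        exact r.refl _
    · have h1 : ∀ x y, r x y → glue (through A) r (.inr x) (.inr y) := fun x y h =>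
        ((glue_le_iff _ _ _).1 le_rfl).2 h
      have h2 : ∀ a : A, glue (through A) r (.inl a) (.inr (.inl a)) := fun a =>
        ((glue_le_iff _ _ _).1 le_rfl).1 (x := .inl a) (y := .inr a) rfl
      have h3 : ∀ x : A ⊕ A ⊕ B, glue (through A) r x (.inr (Sum.elim Sum.inl id x)) := by
        rintro (a | x)
        · exact h2 a
        · exact Setoid.refl' _ _
      intro x y h
      exact Setoid.trans' _ (h3 x) (Setoid.trans' _ (h1 _ _ h) (Setoid.symm' _ (h3 y)))
  constructor
  · rw [stack, hg]
    ext x y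
    rcases x with a | b <;> rcases y with a' | b' <;> rfl
  · rw [loopCount]
    have : IsEmpty (Avoiding (glue (through A) r) IsOuter) := by
      refine ⟨fun ⟨c, hc⟩ => ?_⟩
      induction c using Quotient.inductionOn with
      | _ z =>
        rcases z with a | a | b
        · exact hc (.inl a) trivial rfl
        · refine hc (.inl a) trivial (Quotient.sound ?_)
          change glue _ _ _ _
          rw [hg]; exact r.refl _
        · exact hc (.inr (.inr b)) trivial rfl
    exact Nat.card_of_isEmpty

theorem stack_through_right {A B : Type} (r : Setoid (A ⊕ B)) :
    stack r (through B) = r ∧ loopCount r (through B) = 0 := by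
  have hg : glue r (through B) = r.comap (Sum.elim Sum.inl (Sum.elim Sum.inr Sum.inr)) := by
    refine le_antisymm ?_ ?_
    · rw [glue_le_iff]
      refine ⟨?_, ?_⟩
      · rintro (a | a) (b | b) h <;> exact h
      rintro (a | a) (b | b) h <;>
      · obtain rfl : a = b := h
        exact r.refl _
    · have h1 : ∀ x y, r x y →
          glue r (through B) (Sum.map id Sum.inl x) (Sum.map id Sum.inl y) := fun x y h =>
        ((glue_le_iff _ _ _).1 le_rfl).1 h
      have h2 : ∀ b : B, glue r (through B) (.inr (.inr b)) (.inr (.inl b)) := fun a =>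
        ((glue_le_iff _ _ _).1 le_rfl).2 (x := .inr a) (y := .inl a) rfl
      have h3 : ∀ x : A ⊕ B ⊕ B, glue r (through B) x
          (Sum.map id Sum.inl (Sum.elim Sum.inl (Sum.elim Sum.inr Sum.inr) x)) := by
        rintro (a | b | b)
        · exact Setoid.refl' _ _
        · exact Setoid.refl' _ _
        · exact h2 b
      intro x y h
      exact Setoid.trans' _ (h3 x) (Setoid.trans' _ (h1 _ _ h) (Setoid.symm' _ (h3 y)))
  constructor
  · rw [stack, hg]
    ext x y
    rcases x with a | b <;> rcases y with a' | b' <;> rfl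
  · rw [loopCount]
    have : IsEmpty (Avoiding (glue r (through B)) IsOuter) := by
      refine ⟨fun ⟨c, hc⟩ => ?_⟩
      induction c using Quotient.inductionOn with
      | _ z =>
        rcases z with a | b | b
        · exact hc (.inl a) trivial rfl
        · refine hc (.inr (.inr b)) trivial (Quotient.sound ?_)
          change glue _ _ _ _
          rw [hg]; exact r.refl _
        · exact hc (.inr (.inr b)) trivial rfl
    exact Nat.card_of_isEmpty

/-- Every point is connected to exactly one other point. -/
def IsPairing {X : Type} (r : Setoid X) : Prop := ∀ x, ∃! y, y ≠ x ∧ r x y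

/-- No two arcs cross, for points on a line (or on a circle cut open) ordered by `lt`. -/
def IsNonCrossing {X : Type} (lt : X → X → Prop) (r : Setoid X) : Prop :=
  ∀ x y z w, lt x y → lt y z → lt z w → r x z → ¬ r y w

theorem IsPairing.exists_partner {X : Type} {r : Setoid X} (h : IsPairing r) :
    ∃ f : X → X, (∀ x, f x ≠ x) ∧ (∀ x, r x (f x)) ∧ (∀ x y, y ≠ x → r x y → y = f x) ∧
      ∀ x, f (f x) = x := by
  choose f hf hu using h
  refine ⟨f, fun x => (hf x).1, fun x => (hf x).2, fun x y h1 h2 => hu x y ⟨h1, h2⟩, fun x => ?_⟩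
  exact (hu (f x) x ⟨(hf x).1.symm, r.symm (hf x).2⟩).symm

section pairing

variable {A B C : Type} [Fintype A] [Fintype B] [Fintype C]

theorem even_of_pairing {X : Type} [Fintype X] {r : Setoid X} (h : IsPairing r)
    (χ : X → Prop) [DecidablePred χ] (hχ : ∀ x y, r x y → χ x → χ y) :
    Even (∑ x, if χ x then 1 else 0 : ℕ) := by
  classical
  obtain ⟨f, h1, h2, h3, h4⟩ := h.exists_partner
  have hiff : ∀ x, χ (f x) ↔ χ x := fun x => ⟨hχ _ _ (r.symm (h2 x)), hχ _ _ (h2 x)⟩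
  rw [← ZMod.natCast_eq_zero_iff_even]
  push_cast
  refine Finset.sum_ninvolution f ?_ (fun a _ => h1 a) (fun _ => Finset.mem_univ _) h4
  intro a
  simp only [hiff]
  split_ifs <;> decide

theorem sum_two_le {J : Type} [Fintype J] (p q : J → Prop) [DecidablePred p] [DecidablePred q]
    (h : ∀ j, p j → q j) : (∑ j, if p j then 1 else 0 : ℕ) + (∑ j, if q j then 1 else 0 : ℕ) ≤
      (∑ j, if q j then 2 else 0 : ℕ) := by
  rw [← Finset.sum_add_distrib]
  refine Finset.sum_le_sum fun j _ => ?_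
  have := h j
  split_ifs <;> simp_all

theorem outer_le_two {r : Setoid (A ⊕ B)} {s : Setoid (B ⊕ C)} (hr : IsPairing r)
    (hs : IsPairing s) (v₀ : A ⊕ B ⊕ C) [DecidablePred (glue r s v₀)] :
    (∑ a, if glue r s v₀ (.inl a) then 1 else 0 : ℕ) +
      (∑ c, if glue r s v₀ (.inr (.inr c)) then 1 else 0 : ℕ) ≤ 2 := by
  classical
  obtain ⟨f, -, -, hf, -⟩ := hr.exists_partner
  obtain ⟨g, -, -, hg, -⟩ := hs.exists_partner
  let i₁ : A ⊕ B → A ⊕ B ⊕ C := Sum.map id Sum.inl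
  let i₂ : B ⊕ C → A ⊕ B ⊕ C := Sum.inr
  have hi₁ : i₁.Injective := by
    rintro (a | b) (a' | b') h <;> simp_all [i₁]
  let H : SimpleGraph (A ⊕ B ⊕ C) := SimpleGraph.fromRel fun v w =>
    (∃ a b, r a b ∧ i₁ a = v ∧ i₁ b = w) ∨ (∃ a b, s a b ∧ i₂ a = v ∧ i₂ b = w)
  have hG : glue r s ≤ H.reachableSetoid := by
    rw [glue_le_iff]
    constructor
    · intro x y h
      change H.Reachable (i₁ x) (i₁ y)
      by_cases hxy : i₁ x = i₁ y
      · rw [hxy]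
      · exact SimpleGraph.Adj.reachable ⟨hxy, .inl (.inl ⟨x, y, h, rfl, rfl⟩)⟩
    · intro x y h
      change H.Reachable (i₂ x) (i₂ y)
      by_cases hxy : i₂ x = i₂ y
      · rw [hxy]
      · exact SimpleGraph.Adj.reachable ⟨hxy, .inl (.inr ⟨x, y, h, rfl, rfl⟩)⟩
  -- neighbours
  let N : A ⊕ B ⊕ C → Finset (A ⊕ B ⊕ C) := fun v => match v with
    | .inl a => {i₁ (f (.inl a))}
    | .inr (.inl b) => {i₁ (f (.inr b)), i₂ (g (.inl b))}
    | .inr (.inr c) => {i₂ (g (.inr c))}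
  let wt : A ⊕ B ⊕ C → ℕ := fun v => match v with
    | .inl _ => 1
    | .inr (.inl _) => 2
    | .inr (.inr _) => 1
  have hN : ∀ v, (N v).card ≤ wt v := by
    rintro (a | b | c)
    · simp [N, wt]
    · exact Finset.card_le_two
    · simp [N, wt]
  have hadj : ∀ v w, H.Adj v w → w ∈ N v := by
    have key : ∀ v w, v ≠ w → ((∃ a b, r a b ∧ i₁ a = v ∧ i₁ b = w) ∨
        (∃ a b, s a b ∧ i₂ a = v ∧ i₂ b = w)) → w ∈ N v := by
      rintro v w hne (⟨a, b, hab, rfl, rfl⟩ | ⟨a, b, hab, rfl, rfl⟩)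
      · have := hf a b (fun h => hne (by rw [h])) hab
        subst this
        rcases a with a | a <;> simp [N, i₁]
      · have := hg a b (fun h => hne (by rw [h])) hab
        subst this
        rcases a with a | a <;> simp [N, i₂]
    intro v w h
    rw [SimpleGraph.fromRel_adj] at h
    obtain ⟨hne, h | h⟩ := h
    · exact key v w hne h
    · refine key v w hne ?_
      rcases h with ⟨a, b, hab, rfl, rfl⟩ | ⟨a, b, hab, rfl, rfl⟩
      · exact .inl ⟨b, a, r.symm hab, rfl, rfl⟩
      · exact .inr ⟨b, a, s.symm hab, rfl, rfl⟩
  let c := H.connectedComponentMk v₀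
  have hconn := c.connected_toSimpleGraph
  have hcard := hconn.card_vert_le_card_edgeSet_add_one
  have hdeg : ∀ v : c, c.toSimpleGraph.degree v ≤ wt v := by
    intro v
    refine le_trans ?_ (hN v)
    rw [← SimpleGraph.card_neighborFinset_eq_degree]
    refine Finset.card_le_card_of_injOn Subtype.val ?_ (Subtype.val_injective.injOn)
    intro w hw
    have : c.toSimpleGraph.Adj v w := by simpa using hw
    exact hadj _ _ this
  have hsum := c.toSimpleGraph.sum_degrees_eq_twice_card_edges
  have h1 : ∑ v : c, c.toSimpleGraph.degree v ≤ ∑ v : c, wt v :=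
    Finset.sum_le_sum fun v _ => hdeg v
  have h2 : Nat.card c.toSimpleGraph.edgeSet = c.toSimpleGraph.edgeFinset.card := by
    rw [Nat.card_eq_fintype_card, SimpleGraph.edgeFinset_card]
  have h3 : ∑ v : c, (2 : ℕ) ≤ (∑ v : c, wt v) + 2 := by
    rw [Finset.sum_const, Finset.card_univ, ← Nat.card_eq_fintype_card, smul_eq_mul]
    have : Nat.card c ≤ _ := hcard
    omega
  have hconv : ∀ F : A ⊕ B ⊕ C → ℕ, ∑ v : c, F v = ∑ v, if v ∈ c then F v else 0 := by
    intro F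
    rw [← Finset.sum_filter]
    exact (Finset.sum_subtype (Finset.univ.filter (· ∈ c)) (by intro x; simp) F).symm
  have hmem : ∀ v, glue r s v₀ v → v ∈ c := by
    intro v hv
    exact SimpleGraph.ConnectedComponent.sound (hG hv).symm
  rw [hconv wt, hconv (fun _ => 2)] at h3
  simp only [Fintype.sum_sum_type] at h3
  have h5 := sum_two_le (fun a : A => glue r s v₀ (.inl a)) (fun a : A => (.inl a : A ⊕ B ⊕ C) ∈ c)
    (fun a h => hmem _ h)
  have h6 := sum_two_le (fun a : C => glue r s v₀ (.inr (.inr a)))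
    (fun a : C => (.inr (.inr a) : A ⊕ B ⊕ C) ∈ c) (fun a h => hmem _ h)
  simp only [wt] at h3
  omega

theorem stack_pairing {r : Setoid (A ⊕ B)} {s : Setoid (B ⊕ C)} (hr : IsPairing r)
    (hs : IsPairing s) : IsPairing (stack r s) := by
  classical
  intro x
  set v₀ : A ⊕ B ⊕ C := Sum.map id Sum.inr x with hv₀
  have hle := outer_le_two hr hs v₀
  have e1 := even_of_pairing hr (fun u => glue r s v₀ (Sum.map id Sum.inl u)) (fun u v h h' =>
    Setoid.trans' _ h' (((glue_le_iff _ _ _).1 le_rfl).1 h))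
  have e2 := even_of_pairing hs (fun u => glue r s v₀ (Sum.inr u)) (fun u v h h' =>
    Setoid.trans' _ h' (((glue_le_iff _ _ _).1 le_rfl).2 h))
  have hcard : (Finset.univ.filter (fun y => stack r s x y)).card =
      (∑ a, if glue r s v₀ (.inl a) then 1 else 0 : ℕ) +
      (∑ c, if glue r s v₀ (.inr (.inr c)) then 1 else 0 : ℕ) := by
    rw [Finset.card_filter, Fintype.sum_sum_type]
    rfl
  have hpos : 0 < (Finset.univ.filter (fun y => stack r s x y)).card :=
    Finset.card_pos.2 ⟨x, by simp⟩
  rw [Fintype.sum_sum_type] at e1 e2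
  change Even ((∑ a, if glue r s v₀ (.inl a) then 1 else 0 : ℕ) +
    (∑ b, if glue r s v₀ (.inr (.inl b)) then 1 else 0 : ℕ)) at e1
  change Even ((∑ b, if glue r s v₀ (.inr (.inl b)) then 1 else 0 : ℕ) +
    (∑ c, if glue r s v₀ (.inr (.inr c)) then 1 else 0 : ℕ)) at e2
  have h2 : (Finset.univ.filter (fun y => stack r s x y)).card = 2 := by
    rcases e1 with ⟨p, hp⟩
    rcases e2 with ⟨q, hq⟩
    omega
  have hx : x ∈ Finset.univ.filter (fun y => stack r s x y) := by
    simp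
  have h1 := Finset.card_erase_of_mem hx
  rw [h2] at h1
  obtain ⟨y, hy⟩ := Finset.card_eq_one.1 h1
  have hy' : ∀ z, z ≠ x ∧ stack r s x z ↔ z = y := by
    intro z
    have : z ∈ (Finset.univ.filter (fun y => stack r s x y)).erase x ↔ z = y := by
      rw [hy, Finset.mem_singleton]
    simpa using this
  exact ⟨y, (hy' y).2 rfl, fun z hz => (hy' z).1 hz⟩

end pairing

section planar

theorem line_prod {X G : Type} [Group G] {lt : X → X → Prop} (hirr : ∀ x, ¬ lt x x)
    {r : Setoid X} (hp : IsPairing r) (hn : IsNonCrossing lt r) (ℓ : X → G)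
    (hℓ : ∀ x y, r x y → ℓ x = ℓ y) (hsq : ∀ x, ℓ x * ℓ x = 1) :
    ∀ (n : ℕ) (L : List X), L.length ≤ n → L.Pairwise lt → (∀ x ∈ L, ∀ y, r x y → y ∈ L) →
      (L.map ℓ).prod = 1 := by
  obtain ⟨f, hf1, hf2, hf3, hf4⟩ := hp.exists_partner
  intro n
  induction n with
  | zero =>
    intro L hL _ _
    rw [List.eq_nil_of_length_eq_zero (Nat.le_zero.1 hL)]; rfl
  | succ n ih =>
    intro L hL hs hcl
    cases L with
    | nil => rfl
    | cons x L' =>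
      have hy : f x ∈ L' := by
        have := hcl x (by simp) (f x) (hf2 x)
        rcases List.mem_cons.1 this with h | h
        · exact absurd h (hf1 x)
        · exact h
      obtain ⟨L1, L2, rfl⟩ := List.append_of_mem hy
      rw [List.pairwise_cons, List.pairwise_append, List.pairwise_cons] at hs
      obtain ⟨hx, hs1, ⟨hs3, hs2⟩, hs4⟩ := hs
      -- the partner of a point other than `x`, `f x`
      have hpart : ∀ z ∈ x :: (L1 ++ f x :: L2), z ≠ x → z ≠ f x → f z ∈ L1 ∨ f z ∈ L2 := by
        intro z hz h1 h2
        have := hcl z hz (f z) (hf2 z)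
        rcases List.mem_cons.1 this with h | h
        · exact absurd (by rw [← h, hf4]) h2
        · rcases List.mem_append.1 h with h | h
          · exact .inl h
          · rcases List.mem_cons.1 h with h | h
            · exact absurd (by rw [← hf4 z, h, hf4]) h1
            · exact .inr h
      have n1 : ∀ z ∈ L1, z ≠ x ∧ z ≠ f x := fun z hz =>
        ⟨fun h => hirr x (by have := hx z (by simp [hz]); rwa [h] at this),
          fun h => hirr z (by have := hs4 z hz (f x) (by simp); rwa [← h] at this)⟩
      have n2 : ∀ z ∈ L2, z ≠ x ∧ z ≠ f x := fun z hz =>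
        ⟨fun h => hirr x (by have := hx z (by simp [hz]); rwa [h] at this),
          fun h => hirr z (by have := hs3 z hz; rwa [← h] at this)⟩
      have hcross : ∀ z ∈ L1, ∀ w ∈ L2, ¬ r z w := fun z hz w hw =>
        hn x z (f x) w (hx z (by simp [hz])) (hs4 z hz _ (by simp)) (hs3 w hw) (hf2 x)
      have c1 : ∀ z ∈ L1, ∀ y, r z y → y ∈ L1 := by
        intro z hz y hzy
        by_cases hyz : y = z
        · rwa [hyz]
        obtain rfl := hf3 z y hyz hzy
        rcases hpart z (by simp [hz]) (n1 z hz).1 (n1 z hz).2 with h | h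
        · exact h
        · exact absurd hzy (hcross z hz _ h)
      have c2 : ∀ z ∈ L2, ∀ y, r z y → y ∈ L2 := by
        intro z hz y hzy
        by_cases hyz : y = z
        · rwa [hyz]
        obtain rfl := hf3 z y hyz hzy
        rcases hpart z (by simp [hz]) (n2 z hz).1 (n2 z hz).2 with h | h
        · exact absurd (r.symm hzy) (hcross _ h z hz)
        · exact h
      simp only [List.length_cons, List.length_append] at hL
      have p1 := ih L1 (by omega) hs1 c1
      have p2 := ih L2 (by omega) hs2 c2
      simp only [List.map_cons, List.map_append, List.prod_cons, List.prod_append, p1, p2,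
        ← hℓ x (f x) (hf2 x), one_mul, mul_one, hsq]

theorem not_crossing_of_line_prod {X : Type} {lt : X → X → Prop} (hirr : ∀ x, ¬ lt x x)
    (htr : ∀ x y z, lt x y → lt y z → lt x z)
    {r : Setoid X} (hp : IsPairing r) (L : List X) (hL : L.Pairwise lt) (hall : ∀ x, x ∈ L)
    (h : ∀ ℓ : X → Equiv.Perm (Fin 3), (∀ x y, r x y → ℓ x = ℓ y) → (∀ x, ℓ x * ℓ x = 1) →
      (∃ x y, (∀ u, ¬ r x u → ¬ r y u → ℓ u = 1) ∧ (∀ u, r x u → ℓ u = Equiv.swap 0 1) ∧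
        (∀ u, ¬ r x u → r y u → ℓ u = Equiv.swap 1 2)) → (L.map ℓ).prod = 1) :
    IsNonCrossing lt r := by
  classical
  intro x y z w hxy hyz hzw hxz hyw
  obtain ⟨f, hf1, hf2, hf3, hf4⟩ := hp.exists_partner
  have ne_of : ∀ {a b}, lt a b → a ≠ b := fun h e => hirr _ (by rw [e] at h; exact h)
  have hz : z = f x := hf3 x z (ne_of (htr _ _ _ hxy hyz)).symm hxz
  have hw : w = f y := hf3 y w (ne_of (htr _ _ _ hyz hzw)).symm hyw
  have hnxy : ¬ r x y := fun e =>
    ne_of hyz ((hf3 x y (ne_of hxy).symm e).trans hz.symm)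
  have hx' : ∀ u, r x u ↔ u = x ∨ u = z := fun u => by
    constructor
    · intro e
      by_cases hu : u = x
      · exact .inl hu
      · exact .inr (by rw [hz]; exact hf3 x u hu e)
    · rintro (rfl | rfl)
      · exact r.refl _
      · exact hxz
  have hy' : ∀ u, r y u ↔ u = y ∨ u = w := fun u => by
    constructor
    · intro e
      by_cases hu : u = y
      · exact .inl hu
      · exact .inr (by rw [hw]; exact hf3 y u hu e)
    · rintro (rfl | rfl)
      · exact r.refl _
      · exact hyw
  let ℓ : X → Equiv.Perm (Fin 3) := fun u =>
    if r x u then Equiv.swap 0 1 else if r y u then Equiv.swap 1 2 else 1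
  have hprod := h ℓ
    (fun a b hab => by
      have e1 : r x a ↔ r x b := ⟨fun e => r.trans e hab, fun e => r.trans e (r.symm hab)⟩
      have e2 : r y a ↔ r y b := ⟨fun e => r.trans e hab, fun e => r.trans e (r.symm hab)⟩
      simp only [ℓ, e1, e2])
    (fun a => by
      simp only [ℓ]
      split_ifs <;> simp)
    ⟨x, y, fun u h1 h2 => by simp only [ℓ, if_neg h1, if_neg h2],
      fun u h1 => by simp only [ℓ, if_pos h1],
      fun u h1 h2 => by simp only [ℓ, if_neg h1, if_pos h2]⟩
  let p : X → Bool := fun u => decide (r x u ∨ r y u)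
  have hfil : ∀ L : List X, (L.map ℓ).prod = ((L.filter p).map ℓ).prod := by
    intro L
    induction L with
    | nil => rfl
    | cons u L ih =>
      by_cases hu : r x u ∨ r y u
      · rw [List.filter_cons_of_pos (by simpa [p] using hu)]
        simp [ih]
      · rw [List.filter_cons_of_neg (by simpa [p] using hu)]
        have : ℓ u = 1 := by
          simp only [ℓ, if_neg (fun e => hu (.inl e)), if_neg (fun e => hu (.inr e))]
        simp [ih, this]
  have hsorted : List.Pairwise lt [x, y, z, w] := by
    have h1 := htr _ _ _ hxy hyz
    have h2 := htr _ _ _ hyz hzw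
    have h3 := htr _ _ _ h1 hzw
    simp only [List.pairwise_cons, List.mem_cons, List.not_mem_nil, or_false]
    simp only [forall_eq_or_imp, forall_eq]
    simp [hxy, hyz, hzw, h1, h2, h3]
  have nd : ∀ {L : List X}, L.Pairwise lt → L.Nodup := fun h => h.imp ne_of
  have hperm : (L.filter p).Perm [x, y, z, w] := by
    rw [List.perm_ext_iff_of_nodup ((nd hL).filter _) (nd hsorted)]
    intro u
    simp only [List.mem_filter, hall u, true_and, p, decide_eq_true_eq, hx', hy',
      List.mem_cons, List.not_mem_nil, or_false]
    tauto
  have heq : L.filter p = [x, y, z, w] :=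
    hperm.eq_of_pairwise (fun a b _ _ h1 h2 => absurd (htr _ _ _ h1 h2) (hirr a))
      (hL.filter _) hsorted
  rw [hfil, heq] at hprod
  have l1 : ℓ x = Equiv.swap 0 1 := if_pos (r.refl _)
  have l3 : ℓ z = Equiv.swap 0 1 := if_pos hxz
  have l2 : ℓ y = Equiv.swap 1 2 := by
    simp only [ℓ, if_neg hnxy, if_pos (r.refl y)]
  have l4 : ℓ w = Equiv.swap 1 2 := by
    have : ¬ r x w := fun e => hnxy (r.trans e (r.symm hyw))
    simp only [ℓ, if_neg this, if_pos hyw]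
  simp only [List.map_cons, List.map_nil, List.prod_cons, List.prod_nil, l1, l2, l3, l4] at hprod
  revert hprod
  decide

/-- The boundary points of the square in counterclockwise order, starting at the left end of the
bottom edge: the bottom points from left to right, then the top points from right to left. -/
def Before {m n : ℕ} : Fin m ⊕ Fin n → Fin m ⊕ Fin n → Prop := Sum.Lex (· < ·) (· > ·)

theorem before_irrefl {m n : ℕ} (x : Fin m ⊕ Fin n) : ¬ Before x x := by
  rcases x with x | x <;> simp [Before]

theorem before_trans {m n : ℕ} (x y z : Fin m ⊕ Fin n) : Before x y → Before y z → Before x z := by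
  rcases x with x | x <;> rcases y with y | y <;> rcases z with z | z <;> simp [Before] <;> omega

/-- All boundary points, in order. -/
def boundary (m n : ℕ) : List (Fin m ⊕ Fin n) :=
  (List.finRange m).map Sum.inl ++ (List.finRange n).reverse.map Sum.inr

theorem boundary_pairwise (m n : ℕ) : (boundary m n).Pairwise Before := by
  rw [boundary, List.pairwise_append]
  refine ⟨?_, ?_, ?_⟩
  · rw [List.pairwise_map]
    exact (List.pairwise_lt_finRange m).imp (fun h => by simpa [Before] using h)
  · rw [List.pairwise_map, List.pairwise_reverse]
    exact (List.pairwise_lt_finRange n).imp (fun h => by simpa [Before] using h)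
  · intro a ha b hb
    obtain ⟨a, -, rfl⟩ := List.mem_map.1 ha
    obtain ⟨b, -, rfl⟩ := List.mem_map.1 hb
    exact Sum.Lex.sep _ _

theorem mem_boundary {m n : ℕ} (x : Fin m ⊕ Fin n) : x ∈ boundary m n := by
  rcases x with x | x <;> simp [boundary]

theorem boundary_prod {m n : ℕ} {G : Type} [Group G] (ℓ : Fin m ⊕ Fin n → G)
    (hsq : ∀ x, ℓ x * ℓ x = 1) :
    ((boundary m n).map ℓ).prod = ((List.finRange m).map (fun i => ℓ (.inl i))).prod *
      (((List.finRange n).map (fun i => ℓ (.inr i))).prod)⁻¹ := by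
  rw [boundary, List.map_append, List.prod_append, List.prod_inv_reverse]
  simp only [List.map_map, List.map_reverse]
  have : ∀ x, (ℓ x)⁻¹ = ℓ x := fun x => inv_eq_of_mul_eq_one_left (hsq x)
  congr 4
  funext i
  exact (this (.inr i)).symm

theorem stack_nonCrossing {m n k : ℕ} {r : Setoid (Fin m ⊕ Fin n)} {s : Setoid (Fin n ⊕ Fin k)}
    (hr : IsPairing r) (hs : IsPairing s) (hr' : IsNonCrossing Before r)
    (hs' : IsNonCrossing Before s) : IsNonCrossing Before (stack r s) := by
  classical
  refine not_crossing_of_line_prod before_irrefl before_trans (stack_pairing hr hs)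
    (boundary m k) (boundary_pairwise m k) mem_boundary ?_
  rintro ℓ hℓ hsq ⟨x, y, h1, h2, h3⟩
  let o : Fin m ⊕ Fin k → Fin m ⊕ Fin n ⊕ Fin k := Sum.map id Sum.inr
  let ℓ' : Fin m ⊕ Fin n ⊕ Fin k → Equiv.Perm (Fin 3) := fun v =>
    if glue r s (o x) v then Equiv.swap 0 1 else
      if glue r s (o y) v then Equiv.swap 1 2 else 1
  have hsq' : ∀ v, ℓ' v * ℓ' v = 1 := fun a => by
    simp only [ℓ']
    split_ifs <;> simp
  have hinv : ∀ a b, glue r s a b → ℓ' a = ℓ' b := fun a b hab => by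
    have e1 : ∀ v, glue r s v a ↔ glue r s v b := fun v =>
      ⟨fun e => Setoid.trans' _ e hab, fun e => Setoid.trans' _ e (Setoid.symm' _ hab)⟩
    simp only [ℓ', e1]
  have hout : ∀ u, ℓ' (o u) = ℓ u := by
    intro u
    by_cases hx : stack r s x u
    · rw [h2 u hx]; exact if_pos hx
    · have hx' : ¬ glue r s (o x) (o u) := hx
      by_cases hy : stack r s y u
      · have hy' : glue r s (o y) (o u) := hy
        rw [h3 u hx hy]; simp only [ℓ', if_neg hx', if_pos hy']
      · have hy' : ¬ glue r s (o y) (o u) := hy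
        rw [h1 u hx hy]; simp only [ℓ', if_neg hx', if_neg hy']
  have w1 := line_prod before_irrefl hr hr' (fun u => ℓ' (Sum.map id Sum.inl u))
    (fun a b h => hinv _ _ (((glue_le_iff _ _ _).1 le_rfl).1 h)) (fun _ => hsq' _)
    _ (boundary m n) le_rfl (boundary_pairwise m n) (fun _ _ y _ => mem_boundary y)
  have w2 := line_prod before_irrefl hs hs' (fun u => ℓ' (Sum.inr u))
    (fun a b h => hinv _ _ (((glue_le_iff _ _ _).1 le_rfl).2 h)) (fun _ => hsq' _)
    _ (boundary n k) le_rfl (boundary_pairwise n k) (fun _ _ y _ => mem_boundary y)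
  rw [boundary_prod _ (fun _ => hsq' _), mul_inv_eq_one] at w1 w2
  rw [boundary_prod _ hsq, mul_inv_eq_one]
  simp only [← hout]
  exact w1.trans w2

end planar

/-- Juxtaposition of connection relations. -/
def juxtapose {X Y : Type} (r : Setoid X) (s : Setoid Y) : Setoid (X ⊕ Y) where
  r := Sum.LiftRel r s
  iseqv :=
    { refl := by
        rintro (x | y)
        · exact .inl (r.refl x)
        · exact .inr (s.refl y)
      symm := by
        rintro _ _ (h | h)
        · exact .inl (r.symm h)
        · exact .inr (s.symm h)
      trans := by
        rintro _ _ _ (h | h) (h' | h')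
        · exact .inl (r.trans h h')
        · exact .inr (s.trans h h') }

theorem juxtapose_pairing {X Y : Type} {r : Setoid X} {s : Setoid Y} (hr : IsPairing r)
    (hs : IsPairing s) : IsPairing (juxtapose r s) := by
  rintro (x | y)
  · obtain ⟨z, ⟨h1, h2⟩, h3⟩ := hr x
    refine ⟨.inl z, ⟨by simpa using h1, .inl h2⟩, ?_⟩
    rintro _ ⟨h4, h5 | h5⟩
    rw [h3 _ ⟨by simpa using h4, h5⟩]
  · obtain ⟨z, ⟨h1, h2⟩, h3⟩ := hs y
    refine ⟨.inr z, ⟨by simpa using h1, .inr h2⟩, ?_⟩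
    rintro _ ⟨h4, h5 | h5⟩
    rw [h3 _ ⟨by simpa using h4, h5⟩]

/-- The boundary points of two squares placed side by side. -/
def sideBySide (m n m' n' : ℕ) :
    (Fin m ⊕ Fin n) ⊕ (Fin m' ⊕ Fin n') ≃ Fin (m + m') ⊕ Fin (n + n') :=
  (Equiv.sumSumSumComm _ _ _ _).trans (finSumFinEquiv.sumCongr finSumFinEquiv)

theorem sideBySide_planar {m n m' n' : ℕ} {r : Setoid (Fin m ⊕ Fin n)}
    {s : Setoid (Fin m' ⊕ Fin n')} (hr : IsNonCrossing Before r) (hs : IsNonCrossing Before s) :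
    IsNonCrossing Before ((juxtapose r s).comap (sideBySide m n m' n').symm) := by
  set e := sideBySide m n m' n' with he
  have hl : ∀ p q, Before (e (.inl p)) (e (.inl q)) → Before p q := by
    rintro (p | p) (q | q) <;> simp [he, sideBySide, Before] <;>
      simp only [Fin.lt_def, Fin.val_castAdd] <;> omega
  have hr' : ∀ p q, Before (e (.inr p)) (e (.inr q)) → Before p q := by
    rintro (p | p) (q | q) <;> simp [he, sideBySide, Before]
  have h1 : ∀ p q p' q', Before (e (.inl p)) (e (.inr q)) → Before (e (.inr q)) (e (.inl p')) →
      Before (e (.inl p')) (e (.inr q')) → False := by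
    rintro (p | p) (q | q) (p' | p') (q' | q') <;> simp [he, sideBySide, Before] <;>
      simp only [Fin.lt_def, Fin.le_def, Fin.val_castAdd, Fin.val_natAdd] <;> omega
  have h2 : ∀ p q p' q', Before (e (.inr p)) (e (.inl q)) → Before (e (.inl q)) (e (.inr p')) →
      Before (e (.inr p')) (e (.inl q')) → False := by
    rintro (p | p) (q | q) (p' | p') (q' | q') <;> simp [he, sideBySide, Before] <;>
      simp only [Fin.lt_def, Fin.le_def, Fin.val_castAdd, Fin.val_natAdd] <;> omega
  intro x y z w
  obtain ⟨x, rfl⟩ := e.surjective x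
  obtain ⟨y, rfl⟩ := e.surjective y
  obtain ⟨z, rfl⟩ := e.surjective z
  obtain ⟨w, rfl⟩ := e.surjective w
  intro hxy hyz hzw hxz hyw
  have kxz : Sum.LiftRel r s x z := by
    have h : Sum.LiftRel r s (e.symm (e x)) (e.symm (e z)) := hxz
    rwa [e.symm_apply_apply, e.symm_apply_apply] at h
  have kyw : Sum.LiftRel r s y w := by
    have h : Sum.LiftRel r s (e.symm (e y)) (e.symm (e w)) := hyw
    rwa [e.symm_apply_apply, e.symm_apply_apply] at h
  rcases kxz with kxz | kxz <;> rcases kyw with kyw | kyw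
  · exact hr _ _ _ _ (hl _ _ hxy) (hl _ _ hyz) (hl _ _ hzw) kxz kyw
  · exact h1 _ _ _ _ hxy hyz hzw
  · exact h2 _ _ _ _ hxy hyz hzw
  · exact hs _ _ _ _ (hr' _ _ hxy) (hr' _ _ hyz) (hr' _ _ hzw) kxz kyw

/-- A simple diagram without loops, up to planar isotopy, from `m` points on the bottom edge to
`n` points on the top edge of a square: a non-crossing perfect matching of the `m + n` points.
`conn x y` says that `x = y` or that an arc joins `x` and `y`. -/
@[ext]
structure Diagram (m n : ℕ) where
  conn : Setoid (Fin m ⊕ Fin n)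
  pairing : IsPairing conn
  planar : IsNonCrossing Before conn

namespace Diagram

/-- The diagram consisting of `n` vertical strings. -/
def id (n : ℕ) : Diagram n n where
  conn := through (Fin n)
  pairing := by
    have h : ∀ x y : Fin n ⊕ Fin n, through (Fin n) x y ↔
      Sum.elim _root_.id _root_.id x = Sum.elim _root_.id _root_.id y := fun _ _ => Iff.rfl
    rintro (i | i)
    · refine ⟨.inr i, ⟨by simp, rfl⟩, ?_⟩
      rintro (j | j) ⟨h1, h2⟩ <;> simp_all
    · refine ⟨.inl i, ⟨by simp, rfl⟩, ?_⟩
      rintro (j | j) ⟨h1, h2⟩ <;> simp_all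
  planar := by
    have h : ∀ x y : Fin n ⊕ Fin n, through (Fin n) x y ↔
      Sum.elim _root_.id _root_.id x = Sum.elim _root_.id _root_.id y := fun _ _ => Iff.rfl
    rintro (x | x) (y | y) (z | z) (w | w) <;> simp [Before, h, Fin.ext_iff] <;> omega

/-- The diagram obtained by stacking `g` on top of `f` and deleting all loops. -/
def comp {m n k : ℕ} (f : Diagram m n) (g : Diagram n k) : Diagram m k where
  conn := stack f.conn g.conn
  pairing := stack_pairing f.pairing g.pairing
  planar := stack_nonCrossing f.pairing g.pairing f.planar g.planar

/-- The number of loops that arise when `g` is stacked on top of `f`. -/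
noncomputable def loops {m n k : ℕ} (f : Diagram m n) (g : Diagram n k) : ℕ :=
  loopCount f.conn g.conn

/-- The diagram obtained by placing `f` to the left of `g`. -/
def tensor {m n m' n' : ℕ} (f : Diagram m n) (g : Diagram m' n') :
    Diagram (m + m') (n + n') where
  conn := (juxtapose f.conn g.conn).comap (sideBySide m n m' n').symm
  pairing := by
    intro x
    obtain ⟨z, ⟨h1, h2⟩, h3⟩ := juxtapose_pairing f.pairing g.pairing
      ((sideBySide m n m' n').symm x)
    refine ⟨sideBySide m n m' n' z, ⟨fun h => h1 (by rw [← h]; simp), by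
      simpa [Setoid.comap_rel] using h2⟩, ?_⟩
    rintro y ⟨h4, h5⟩
    rw [← h3 ((sideBySide m n m' n').symm y) ⟨by simpa using h4, h5⟩]
    simp
  planar := sideBySide_planar f.planar g.planar

/-- The diagram from `0` to `2` points consisting of one cup. -/
def cup : Diagram 0 2 where
  conn := ⊤
  pairing := by
    rintro (x | x)
    · exact x.elim0
    · refine ⟨.inr (1 - x), ⟨by fin_cases x <;> simp, trivial⟩, ?_⟩
      rintro (y | y) ⟨h, -⟩
      · exact y.elim0
      · fin_cases x <;> fin_cases y <;> simp_all
  planar := by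
    rintro (x | x) (y | y) (z | z) (w | w) <;> simp [Before] <;> omega

/-- The diagram from `2` to `0` points consisting of one cap. -/
def cap : Diagram 2 0 where
  conn := ⊤
  pairing := by
    rintro (x | x)
    · refine ⟨.inl (1 - x), ⟨by fin_cases x <;> simp, trivial⟩, ?_⟩
      rintro (y | y) ⟨h, -⟩
      · fin_cases x <;> fin_cases y <;> simp_all
      · exact y.elim0
    · exact x.elim0
  planar := by
    rintro (x | x) (y | y) (z | z) (w | w) <;> simp [Before] <;> omega

theorem id_comp {m n : ℕ} (f : Diagram m n) : (id m).comp f = f :=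
  Diagram.ext (stack_through_left f.conn).1

theorem comp_id {m n : ℕ} (f : Diagram m n) : f.comp (id n) = f :=
  Diagram.ext (stack_through_right f.conn).1

theorem assoc {m n k l : ℕ} (f : Diagram m n) (g : Diagram n k) (h : Diagram k l) :
    (f.comp g).comp h = f.comp (g.comp h) :=
  Diagram.ext (stack_assoc f.conn g.conn h.conn)

theorem loops_id_left {m n : ℕ} (f : Diagram m n) : (id m).loops f = 0 :=
  (stack_through_left f.conn).2

theorem loops_id_right {m n : ℕ} (f : Diagram m n) : f.loops (id n) = 0 :=
  (stack_through_right f.conn).2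

theorem loops_assoc {m n k l : ℕ} (f : Diagram m n) (g : Diagram n k) (h : Diagram k l) :
    f.loops g + (f.comp g).loops h = g.loops h + f.loops (g.comp h) :=
  loopCount_assoc f.conn g.conn h.conn

end Diagram

/-- The ground field `ℂ(q)`. -/
abbrev K : Type := RatFunc ℂ

/-- The formal parameter. -/
noncomputable def q : K := RatFunc.X

/-- The quantum integer `[n]`. -/
noncomputable def quantumInt (n : ℕ) : K := (q ^ (n : ℤ) - q ^ (-(n : ℤ))) / (q - q⁻¹)

/-- The loop variable `d = [2]`. -/
noncomputable def loopVar : K := q + q⁻¹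

/-- Formal diagrams: linear combinations of loopless simple diagrams. -/
abbrev FormalDiagram (m n : ℕ) : Type := Diagram m n →₀ K

/-- A simple diagram as a formal diagram. -/
noncomputable def ofDiagram {m n : ℕ} (f : Diagram m n) : FormalDiagram m n := Finsupp.single f 1

/-- The bilinear extension of stacking (second argument on top), where each loop is replaced by
the factor `d`. -/
noncomputable def compose (m n k : ℕ) :
    FormalDiagram m n →ₗ[K] FormalDiagram n k →ₗ[K] FormalDiagram m k :=
  Finsupp.linearCombination K fun f =>
    Finsupp.linearCombination K fun g => loopVar ^ f.loops g • ofDiagram (f.comp g)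

/-- The bilinear extension of horizontal juxtaposition. -/
noncomputable def tensor {m n m' n' : ℕ} (f : FormalDiagram m n) (g : FormalDiagram m' n') :
    FormalDiagram (m + m') (n + n') :=
  Finsupp.linearCombination K
    (fun a => Finsupp.linearCombination K fun b => ofDiagram (Diagram.tensor a b)) f g

theorem compose_ofDiagram {m n k : ℕ} (f : Diagram m n) (g : Diagram n k) :
    compose m n k (ofDiagram f) (ofDiagram g) = loopVar ^ f.loops g • ofDiagram (f.comp g) := by
  simp [compose, ofDiagram]

theorem compose_id_left {m n : ℕ} (f : FormalDiagram m n) :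
    compose m m n (ofDiagram (Diagram.id m)) f = f := by
  induction f using Finsupp.induction_linear with
  | zero => simp
  | add f g hf hg => rw [map_add, hf, hg]
  | single a c =>
    have : Finsupp.single a c = c • ofDiagram a := by simp [ofDiagram]
    rw [this, map_smul, compose_ofDiagram, Diagram.loops_id_left, Diagram.id_comp, pow_zero, one_smul]

theorem compose_id_right {m n : ℕ} (f : FormalDiagram m n) :
    compose m n n f (ofDiagram (Diagram.id n)) = f := by
  induction f using Finsupp.induction_linear with
  | zero => simp
  | add f g hf hg => rw [map_add, LinearMap.add_apply, hf, hg]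
  | single a c =>
    have : Finsupp.single a c = c • ofDiagram a := by simp [ofDiagram]
    rw [this, map_smul, LinearMap.smul_apply, compose_ofDiagram, Diagram.loops_id_right,
      Diagram.comp_id, pow_zero, one_smul]

theorem compose_assoc {m n k l : ℕ} (f : FormalDiagram m n) (g : FormalDiagram n k)
    (h : FormalDiagram k l) :
    compose m k l (compose m n k f g) h = compose m n l f (compose n k l g h) := by
  induction f using Finsupp.induction_linear with
  | zero => simp
  | add f f' hf hf' => simp only [map_add, LinearMap.add_apply, hf, hf']
  | single a x =>
  induction g using Finsupp.induction_linear with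
  | zero => simp
  | add f f' hf hf' => simp only [map_add, LinearMap.add_apply, hf, hf']
  | single b y =>
  induction h using Finsupp.induction_linear with
  | zero => simp
  | add f f' hf hf' => simp only [map_add, hf, hf']
  | single c z =>
    have : ∀ {m n : ℕ} (a : Diagram m n) (x : K), Finsupp.single a x = x • ofDiagram a := by
      simp [ofDiagram]
    simp only [this, map_smul, LinearMap.smul_apply, compose_ofDiagram, smul_smul, Diagram.assoc]
    congr 1
    have := congrArg (fun e => loopVar ^ e) (Diagram.loops_assoc a b c)
    simp only [pow_add] at this
    linear_combination x * y * z * this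

/-- The generic Temperley-Lieb category; its objects are the natural numbers. -/
structure TL where
  points : ℕ

noncomputable instance instCategoryTL : Category TL where
  Hom X Y := FormalDiagram X.points Y.points
  id X := ofDiagram (Diagram.id X.points)
  comp f g := compose _ _ _ f g
  id_comp := compose_id_left
  comp_id := compose_id_right
  assoc := compose_assoc

noncomputable instance instPreadditiveTL : Preadditive TL where
  homGroup X Y := inferInstanceAs (AddCommGroup (FormalDiagram X.points Y.points))
  add_comp X Y Z f f' g := by
    exact (compose X.points Y.points Z.points).map_add₂ f f' g
  comp_add X Y Z f g g' := by
    exact (compose X.points Y.points Z.points f).map_add g g'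

noncomputable instance instLinearTL : Linear K TL where
  homModule X Y := inferInstanceAs (Module K (FormalDiagram X.points Y.points))
  smul_comp X Y Z c f g := by
    exact (compose X.points Y.points Z.points).map_smul₂ c f g
  comp_smul X Y Z f c g := by
    exact (compose X.points Y.points Z.points f).map_smul c g

/-- The Jones-Wenzl elements `p n`, where
`p (n + 1) = p n ⊗ 1 - [n] / [n + 1] • (p n ⊗ 1) ∘ (1 ⊗ (cup ∘ cap)) ∘ (p n ⊗ 1)` for `1 ≤ n`. -/
noncomputable def jonesWenzl : (n : ℕ) → ((⟨n⟩ : TL) ⟶ ⟨n⟩)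
  | 0 => 𝟙 _
  | 1 => 𝟙 _
  | n + 2 =>
    let p : (⟨n + 2⟩ : TL) ⟶ ⟨n + 2⟩ := tensor (m := n + 1) (n := n + 1) (m' := 1) (n' := 1)
      (jonesWenzl (n + 1)) (ofDiagram (Diagram.id 1))
    let u : (⟨n + 2⟩ : TL) ⟶ ⟨n + 2⟩ :=
      tensor (ofDiagram (Diagram.id n)) (compose 2 0 2 (ofDiagram Diagram.cap) (ofDiagram Diagram.cup))
    p - (quantumInt (n + 1) / quantumInt (n + 2)) • (p ≫ u ≫ p)

section linear

variable {R C : Type*} [Field R] [Category C] [Preadditive C] [Linear R C]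

/-- Morphisms of the Karoubi envelope are scaled as in the underlying category. -/
instance instSMulKaroubiHom (P Q : Karoubi C) : SMul R (P ⟶ Q) where
  smul c f := ⟨c • f.f, by rw [Linear.smul_comp, Linear.comp_smul, f.comm]⟩

theorem karoubi_smul_f {P Q : Karoubi C} (c : R) (f : P ⟶ Q) : (c • f).f = c • f.f := rfl

instance instLinearKaroubi : Linear R (Karoubi C) where
  homModule P Q :=
    { one_smul := fun f => by ext; exact one_smul R f.f
      mul_smul := fun a b f => by ext; exact mul_smul a b f.f
      smul_zero := fun a => by ext; exact smul_zero a
      smul_add := fun a f g => by ext; exact smul_add a f.f g.f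
      add_smul := fun a b f => by ext; exact add_smul a b f.f
      zero_smul := fun f => by ext; exact zero_smul R f.f }
  smul_comp P Q S c f g := by ext; exact Linear.smul_comp _ _ _ c f.f g.f
  comp_smul P Q S f c g := by ext; exact Linear.comp_smul _ _ _ f.f c g.f

variable (R)

/-- An object `X` of a linear category is simple if `Hom(X, X)` is spanned by the identity. -/
def IsSimpleObject (X : C) : Prop :=
  Submodule.span R {𝟙 X} = (⊤ : Submodule R (X ⟶ X))

/-- A collection of simple objects with no nonzero morphisms between different members. -/
def IsDisjointSimple (S : Set C) : Prop :=
  (∀ X ∈ S, IsSimpleObject R X) ∧ ∀ X ∈ S, ∀ Y ∈ S, X ≠ Y → ∀ f : X ⟶ Y, f = 0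

end linear

end TemperleyLieb

open TemperleyLieb

/-!
Two facts carry the proof.

*The Jones-Wenzl elements kill all turnbacks.* Write `p n` for `jonesWenzl n` and `u i` for the
generator with a cap and a cup at the positions `i`, `i + 1` (the predicate `Diagram.IsHook`), and
regard an endomorphism of `n` as one of `n + 1` by adding a string on the right (`addStrand`). The
relations `u i ^ 2 = d u i` (`lastHook_comp_self`) and `u (i + 1) u i u (i + 1) = u (i + 1)`
(`lastHook_comp_addStrand_comp`), and the fact that the last generator commutes with whatever lives
on the strings to its left (`addStrand_addStrand_comp_lastHook`), give by induction on `n` that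
`p (n + 1)` is idempotent, absorbs `p n`, and satisfies the partial trace formula
`u n p (n + 1) u n = [n + 2] / [n + 1] p n u n`. By this formula the correction term in the
definition of `p (n + 2)` is exactly what makes `p (n + 2) u n = 0 = u n p (n + 2)` (`wenzl_step`,
`wenzl_partial_trace`); the other generators are killed already by `p (n + 1)`, which `p (n + 2)`
absorbs.

*Every diagram except the identities has a turnback.* An innermost arc among those with both
endpoints on the same edge joins two neighbours, so a diagram without arcs between neighbours of
one edge joins every bottom point to a top point; planarity makes this bijection monotone, hence it
is the identity (`Diagram.exists_orderIso_of_no_turnback`). If `D` joins two neighbouring bottom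
points, stacking it on the generator `u` at that position changes it only by a power of `d`
(`Diagram.IsHook.comp_eq`). As `d ≠ 0`, it follows that `p m ≫ D = 0`, and dually for the top edge.

Therefore `p m ≫ f ≫ p n` vanishes for `m ≠ n`, and for `m = n` it is a multiple of `p n`, namely by
the coefficient of the identity diagram in `f`. A morphism `f` in the Karoubi envelope from `p m` to
`p n` is its own compression `p m ≫ f ≫ p n`.

Closed loops are counted only for the relations between generators and for juxtapositions, where
exact coefficients matter; for the absorption of turnbacks any power of `d` will do. Equalities of
diagrams come down to exhibiting the arcs of one diagram in the other (`Diagram.eq_of_conn_le`).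
-/

namespace TemperleyLieb

/-! ### Diagrams from their arcs -/

namespace Diagram

/-- A perfect matching is maximal among perfect matchings, so two diagrams agree as soon as every
arc of the first is an arc of the second. -/
theorem eq_of_conn_le {m n : ℕ} {f g : Diagram m n} (h : f.conn ≤ g.conn) : f = g := by
  refine Diagram.ext (le_antisymm h fun x y hxy => ?_)
  by_cases hne : y = x
  · rw [hne]
  · obtain ⟨z, ⟨hz, hxz⟩, -⟩ := f.pairing x
    obtain ⟨w, -, hw⟩ := g.pairing x
    rwa [hw y ⟨hne, hxy⟩, ← hw z ⟨hz, h hxz⟩]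

end Diagram

theorem glue_lower {A B C : Type} (r : Setoid (A ⊕ B)) (s : Setoid (B ⊕ C)) {x y : A ⊕ B}
    (h : r x y) : glue r s (Sum.map id Sum.inl x) (Sum.map id Sum.inl y) :=
  ((glue_le_iff r s _).1 le_rfl).1 h

theorem glue_upper {A B C : Type} (r : Setoid (A ⊕ B)) (s : Setoid (B ⊕ C)) {x y : B ⊕ C}
    (h : s x y) : glue r s (Sum.inr x) (Sum.inr y) :=
  ((glue_le_iff r s _).1 le_rfl).2 h

theorem finite_avoiding {Z : Type} [Finite Z] (S : Setoid Z) (D : Z → Prop) :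
    Finite (Avoiding S D) :=
  inferInstanceAs (Finite {c : Quotient S // ∀ z, D z → Quotient.mk S z ≠ c})

/-- No loop arises when every middle point is connected to an outer point. -/
theorem loopCount_eq_zero {A B C : Type} (r : Setoid (A ⊕ B)) (s : Setoid (B ⊕ C))
    (h : ∀ b, ∃ z, IsOuter z ∧ glue r s z (.inr (.inl b))) : loopCount r s = 0 := by
  have : IsEmpty (Avoiding (glue r s) IsOuter) := by
    refine ⟨?_⟩
    rintro ⟨⟨a | b | c⟩, hc⟩
    · exact hc (.inl a) trivial rfl
    · obtain ⟨z, hz, hzb⟩ := h b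
      exact hc z hz (Quotient.sound hzb)
    · exact hc (.inr (.inr c)) trivial rfl
  exact Nat.card_of_isEmpty

/-! ### Juxtaposition and stacking -/

/-- The classes of a disjoint union of two equivalence relations, counted separately. -/
theorem card_avoiding_of_juxtapose {X Y Z : Type} [Finite X] [Finite Y] (R : Setoid X)
    (R' : Setoid Y) (S : Setoid Z) (e : X ⊕ Y ≃ Z)
    (hS : ∀ u v, S (e u) (e v) ↔ juxtapose R R' u v) (D : Z → Prop) :
    Nat.card (Avoiding S D) = Nat.card (Avoiding R fun x => D (e (.inl x))) +
      Nat.card (Avoiding R' fun y => D (e (.inr y))) := by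
  have := finite_avoiding R fun x => D (e (.inl x))
  have := finite_avoiding R' fun y => D (e (.inr y))
  have hl : ∀ x x', S (e (.inl x)) (e (.inl x')) ↔ R x x' := fun x x' =>
    (hS _ _).trans ⟨fun h => by cases h; assumption, fun h => .inl h⟩
  have hr : ∀ x x', S (e (.inr x)) (e (.inr x')) ↔ R' x x' := fun x x' =>
    (hS _ _).trans ⟨fun h => by cases h; assumption, fun h => .inr h⟩
  have hlr : ∀ x y, ¬ S (e (.inl x)) (e (.inr y)) := fun x y h => by
    cases (hS _ _).1 h
  let F : Quotient R ⊕ Quotient R' → Quotient S :=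
    Sum.elim (Quotient.lift (fun x => Quotient.mk S (e (.inl x)))
        fun _ _ h => Quotient.sound ((hl _ _).2 h))
      (Quotient.lift (fun x => Quotient.mk S (e (.inr x)))
        fun _ _ h => Quotient.sound ((hr _ _).2 h))
  have hF : F.Bijective := by
    constructor
    · rintro (a | a) (b | b) <;> induction a using Quotient.inductionOn <;>
        induction b using Quotient.inductionOn <;> intro h
      · exact congrArg _ (Quotient.sound ((hl _ _).1 (Quotient.exact h)))
      · exact absurd (Quotient.exact h) (hlr _ _)
      · exact absurd (S.symm (Quotient.exact h)) (hlr _ _)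
      · exact congrArg _ (Quotient.sound ((hr _ _).1 (Quotient.exact h)))
    · intro c
      induction c using Quotient.inductionOn with
      | _ z =>
        obtain ⟨x | y, rfl⟩ := e.surjective z
        · exact ⟨.inl (Quotient.mk R x), rfl⟩
        · exact ⟨.inr (Quotient.mk R' y), rfl⟩
  let P : Quotient R ⊕ Quotient R' → Prop :=
    Sum.elim (fun c => ∀ x, D (e (.inl x)) → Quotient.mk R x ≠ c)
      (fun c => ∀ y, D (e (.inr y)) → Quotient.mk R' y ≠ c)
  have hP : ∀ c, P c ↔ ∀ z, D z → Quotient.mk S z ≠ F c := by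
    have hcov : ∀ z, ∃ u, z = e u := fun z => ⟨e.symm z, by simp⟩
    rintro (c | c) <;> induction c using Quotient.inductionOn with | _ w => ?_
    · constructor
      · intro h z hz heq
        obtain ⟨x | y, rfl⟩ := hcov z
        · exact h x hz (Quotient.sound ((hl _ _).1 (Quotient.exact heq)))
        · exact hlr _ _ (S.symm (Quotient.exact heq))
      · intro h x hx heq
        exact h _ hx (Quotient.sound ((hl _ _).2 (Quotient.exact heq)))
    · constructor
      · intro h z hz heq
        obtain ⟨x | y, rfl⟩ := hcov z
        · exact hlr _ _ (Quotient.exact heq)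
        · exact h y hz (Quotient.sound ((hr _ _).1 (Quotient.exact heq)))
      · intro h x hx heq
        exact h _ hx (Quotient.sound ((hr _ _).2 (Quotient.exact heq)))
  have E : {c // P c} ≃ Avoiding S D := (Equiv.ofBijective F hF).subtypeEquiv hP
  rw [← Nat.card_congr E, Nat.card_congr (Equiv.subtypeSum (p := P)), Nat.card_sum]
  rfl

namespace Diagram

theorem tensor_conn {m n m' n' : ℕ} (f : Diagram m n) (g : Diagram m' n')
    (x y : (Fin m ⊕ Fin n) ⊕ (Fin m' ⊕ Fin n')) :
    (f.tensor g).conn (sideBySide m n m' n' x) (sideBySide m n m' n' y) ↔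
      juxtapose f.conn g.conn x y := by
  change juxtapose f.conn g.conn ((sideBySide m n m' n').symm _) ((sideBySide m n m' n').symm _) ↔ _
  rw [Equiv.symm_apply_apply, Equiv.symm_apply_apply]

theorem tensor_conn_left {m n m' n' : ℕ} (f : Diagram m n) (g : Diagram m' n')
    {x y : Fin m ⊕ Fin n} (h : f.conn x y) :
    (f.tensor g).conn (Sum.map (Fin.castAdd m') (Fin.castAdd n') x)
      (Sum.map (Fin.castAdd m') (Fin.castAdd n') y) := by
  have key := (tensor_conn f g (.inl x) (.inl y)).2 (.inl h)
  rcases x with x | x <;> rcases y with y | y <;> exact key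

theorem tensor_conn_right {m n m' n' : ℕ} (f : Diagram m n) (g : Diagram m' n')
    {x y : Fin m' ⊕ Fin n'} (h : g.conn x y) :
    (f.tensor g).conn (Sum.map (Fin.natAdd m) (Fin.natAdd n) x)
      (Sum.map (Fin.natAdd m) (Fin.natAdd n) y) := by
  have key := (tensor_conn f g (.inr x) (.inr y)).2 (.inr h)
  rcases x with x | x <;> rcases y with y | y <;> exact key

theorem tensor_conn_le {m n m' n' : ℕ} (f : Diagram m n) (g : Diagram m' n')
    {S : Setoid (Fin (m + m') ⊕ Fin (n + n'))}
    (hf : f.conn ≤ S.comap (Sum.map (Fin.castAdd m') (Fin.castAdd n')))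
    (hg : g.conn ≤ S.comap (Sum.map (Fin.natAdd m) (Fin.natAdd n))) :
    (f.tensor g).conn ≤ S := by
  intro x y h
  obtain ⟨x, rfl⟩ := (sideBySide m n m' n').surjective x
  obtain ⟨y, rfl⟩ := (sideBySide m n m' n').surjective y
  have key := (tensor_conn f g x y).1 h
  rcases x with x | x <;> rcases y with y | y <;> rcases key with key | key
  · replace key := hf key
    rcases x with x | x <;> rcases y with y | y <;> exact key
  · replace key := hg key
    rcases x with x | x <;> rcases y with y | y <;> exact key

/-- The bottom, middle and top points of two stacks placed side by side. -/
def stacksSideBySide (a b c a' b' c' : ℕ) :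
    (Fin a ⊕ Fin b ⊕ Fin c) ⊕ (Fin a' ⊕ Fin b' ⊕ Fin c') ≃
      Fin (a + a') ⊕ Fin (b + b') ⊕ Fin (c + c') :=
  (Equiv.sumSumSumComm _ _ _ _).trans (finSumFinEquiv.sumCongr (sideBySide b c b' c'))

section interchange

variable {a b c a' b' c' : ℕ} (f : Diagram a b) (g : Diagram a' b') (f' : Diagram b c)
  (g' : Diagram b' c')

/-- The relation on all points of two stacks placed side by side is the disjoint union of the
relations on the points of either stack. -/
theorem glue_tensor (u v : (Fin a ⊕ Fin b ⊕ Fin c) ⊕ (Fin a' ⊕ Fin b' ⊕ Fin c')) :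
    glue (f.tensor g).conn (f'.tensor g').conn (stacksSideBySide a b c a' b' c' u)
      (stacksSideBySide a b c a' b' c' v) ↔
    juxtapose (glue f.conn f'.conn) (glue g.conn g'.conn) u v := by
  set e := stacksSideBySide a b c a' b' c' with he
  set G := glue (f.tensor g).conn (f'.tensor g').conn with hG
  set J := juxtapose (glue f.conn f'.conn) (glue g.conn g'.conn) with hJ
  have h1 : glue f.conn f'.conn ≤ G.comap (fun x => e (.inl x)) := by
    rw [glue_le_iff]
    constructor
    · intro x y h
      have key := glue_lower _ (f'.tensor g').conn (tensor_conn_left f g h)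
      rcases x with x | x <;> rcases y with y | y <;> exact key
    · intro x y h
      have key := glue_upper (f.tensor g).conn _ (tensor_conn_left f' g' h)
      rcases x with x | x <;> rcases y with y | y <;> exact key
  have h2 : glue g.conn g'.conn ≤ G.comap (fun x => e (.inr x)) := by
    rw [glue_le_iff]
    constructor
    · intro x y h
      have key := glue_lower _ (f'.tensor g').conn (tensor_conn_right f g h)
      rcases x with x | x <;> rcases y with y | y <;> exact key
    · intro x y h
      have key := glue_upper (f.tensor g).conn _ (tensor_conn_right f' g' h)
      rcases x with x | x <;> rcases y with y | y <;> exact key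
  have hJe : ∀ u v, J u v → J.comap e.symm (e u) (e v) := fun u v h => by
    rw [Setoid.comap_rel]
    simpa using h
  have h3 : G ≤ J.comap e.symm := by
    rw [hG, glue_le_iff]
    constructor <;> refine tensor_conn_le _ _ ?_ ?_ <;> intro x y h
    · have key := hJe _ _ (.inl (glue_lower _ f'.conn h))
      rcases x with x | x <;> rcases y with y | y <;> exact key
    · have key := hJe _ _ (.inr (glue_lower _ g'.conn h))
      rcases x with x | x <;> rcases y with y | y <;> exact key
    · have key := hJe _ _ (.inl (glue_upper f.conn _ h))
      rcases x with x | x <;> rcases y with y | y <;> exact key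
    · have key := hJe _ _ (.inr (glue_upper g.conn _ h))
      rcases x with x | x <;> rcases y with y | y <;> exact key
  constructor
  · intro h
    have key := h3 h
    rw [Setoid.comap_rel] at key
    simpa using key
  · rintro (h | h)
    · exact h1 h
    · exact h2 h

/-- The interchange law. -/
theorem tensor_comp_tensor :
    (f.tensor g).comp (f'.tensor g') = (f.comp f').tensor (g.comp g') := by
  refine (eq_of_conn_le (tensor_conn_le _ _ ?_ ?_)).symm <;> intro x y h
  · have key := (glue_tensor f g f' g' _ _).2 (.inl h)
    rcases x with x | x <;> rcases y with y | y <;> exact key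
  · have key := (glue_tensor f g f' g' _ _).2 (.inr h)
    rcases x with x | x <;> rcases y with y | y <;> exact key

theorem loops_tensor :
    (f.tensor g).loops (f'.tensor g') = f.loops f' + g.loops g' := by
  rw [loops, loopCount, card_avoiding_of_juxtapose _ _ _ _ (glue_tensor f g f' g')]
  congr 2
  · congr 1
    funext x
    rcases x with x | x | x <;> rfl
  · congr 1
    funext x
    rcases x with x | x | x <;> rfl

end interchange

theorem tensor_id_one_tensor_id_one {m n : ℕ} (f : Diagram m n) :
    (f.tensor (id 1)).tensor (id 1) = f.tensor (id 2) := by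
  symm
  refine eq_of_conn_le (m := m + 2) (n := n + 2) (tensor_conn_le f (id 2) ?_ ?_)
  · intro x y h
    have key := tensor_conn_left _ (id 1) (tensor_conn_left f (id 1) h)
    rcases x with x | x <;> rcases y with y | y <;> exact key
  · intro x y h
    have key : ∀ i : Fin 2, ((f.tensor (id 1)).tensor (id 1)).conn
        (.inl (Fin.natAdd m i)) (.inr (Fin.natAdd n i)) := by
      intro i
      have h1 : (id 1).conn (.inl 0) (.inr 0) := rfl
      fin_cases i
      · exact tensor_conn_left _ (id 1) (tensor_conn_right f (id 1) h1)
      · exact tensor_conn_right (f.tensor (id 1)) (id 1) h1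
    have key' := fun i => Setoid.symm' _ (key i)
    rcases x with x | x <;> rcases y with y | y <;> obtain rfl : x = y := h
    · exact Setoid.refl' _ _
    · exact key _
    · exact key' _
    · exact Setoid.refl' _ _

theorem id_tensor_id (m n : ℕ) : (id m).tensor (id n) = id (m + n) := by
  refine eq_of_conn_le (tensor_conn_le _ _ ?_ ?_)
  all_goals
    intro x y h
    rcases x with x | x <;> rcases y with y | y <;> obtain rfl : x = y := h <;> rfl

/-! ### Hooks -/

/-- The diagram `E` joins the `i`-th and the `(i + 1)`-st bottom points, likewise the top points,
and consists of vertical strings otherwise; in other words, it is the standard generator of the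
Temperley-Lieb algebra at position `i` (counted from `0`). -/
structure IsHook {n : ℕ} (i : ℕ) (E : Diagram n n) : Prop where
  cap : ∀ a b : Fin n, a.val = i → b.val = i + 1 → E.conn (.inl a) (.inl b)
  cup : ∀ a b : Fin n, a.val = i → b.val = i + 1 → E.conn (.inr a) (.inr b)
  string : ∀ j : Fin n, j.val ≠ i → j.val ≠ i + 1 → E.conn (.inl j) (.inr j)

theorem isHook_id_tensor_cap_comp_cup (n : ℕ) :
    IsHook n ((id n).tensor (Diagram.cap.comp Diagram.cup)) where
  cap a b ha hb := by
    obtain rfl : a = Fin.natAdd n 0 := Fin.ext ha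
    obtain rfl : b = Fin.natAdd n 1 := Fin.ext hb
    refine tensor_conn_right (id n) (Diagram.cap.comp Diagram.cup) (x := .inl 0) (y := .inl 1) ?_
    exact glue_lower Diagram.cap.conn Diagram.cup.conn (x := .inl 0) (y := .inl 1) trivial
  cup a b ha hb := by
    obtain rfl : a = Fin.natAdd n 0 := Fin.ext ha
    obtain rfl : b = Fin.natAdd n 1 := Fin.ext hb
    refine tensor_conn_right (id n) (Diagram.cap.comp Diagram.cup) (x := .inr 0) (y := .inr 1) ?_
    exact glue_upper Diagram.cap.conn Diagram.cup.conn (x := .inr 0) (y := .inr 1) trivial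
  string j h1 h2 := by
    obtain ⟨k, rfl⟩ : ∃ k : Fin n, j = Fin.castAdd 2 k := ⟨⟨j, by omega⟩, rfl⟩
    exact tensor_conn_left (id n) _ (x := .inl k) (y := .inr k) rfl

theorem IsHook.tensor_id_one {n i : ℕ} {E : Diagram n n} (hE : IsHook i E) (hi : i + 2 ≤ n) :
    IsHook i (E.tensor (id 1)) where
  cap a b ha hb := by
    obtain ⟨a, rfl⟩ : ∃ k : Fin n, a = Fin.castAdd 1 k := ⟨⟨a, by omega⟩, rfl⟩
    obtain ⟨b, rfl⟩ : ∃ k : Fin n, b = Fin.castAdd 1 k := ⟨⟨b, by omega⟩, rfl⟩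
    exact tensor_conn_left E _ (hE.cap a b ha hb)
  cup a b ha hb := by
    obtain ⟨a, rfl⟩ : ∃ k : Fin n, a = Fin.castAdd 1 k := ⟨⟨a, by omega⟩, rfl⟩
    obtain ⟨b, rfl⟩ : ∃ k : Fin n, b = Fin.castAdd 1 k := ⟨⟨b, by omega⟩, rfl⟩
    exact tensor_conn_left E _ (hE.cup a b ha hb)
  string j h1 h2 := by
    by_cases hj : j.val < n
    · obtain ⟨j, rfl⟩ : ∃ k : Fin n, j = Fin.castAdd 1 k := ⟨⟨j, hj⟩, rfl⟩
      exact tensor_conn_left E _ (hE.string j h1 h2)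
    · obtain rfl : j = Fin.natAdd n 0 := Fin.ext (by simp; omega)
      exact tensor_conn_right E (id 1) (x := .inl 0) (y := .inr 0) rfl

/-- A diagram with a cap at position `i` absorbs a hook at that position stacked below it. -/
theorem IsHook.comp_eq {m n i : ℕ} {E : Diagram m m} (hE : IsHook i E) {D : Diagram m n}
    (hD : ∀ a b : Fin m, a.val = i → b.val = i + 1 → D.conn (.inl a) (.inl b))
    (hi : i + 2 ≤ m) : E.comp D = D := by
  symm
  obtain ⟨a, ha⟩ : ∃ a : Fin m, a.val = i := ⟨⟨i, by omega⟩, rfl⟩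
  obtain ⟨b, hb⟩ : ∃ b : Fin m, b.val = i + 1 := ⟨⟨i + 1, by omega⟩, rfl⟩
  have hab := hD a b ha hb
  set G := glue E.conn D.conn with hG
  have hcap : G (.inl a) (.inl b) := glue_lower E.conn D.conn (hE.cap a b ha hb)
  -- away from the cap, a point of `D` continues to an outer point of the stack
  have hcont : ∀ x : Fin m ⊕ Fin n, x ≠ .inl a → x ≠ .inl b →
      G (Sum.map _root_.id Sum.inr x) (.inr x) := by
    rintro (x | x) hxa hxb
    · refine glue_lower E.conn D.conn (x := .inl x) (y := .inr x) (hE.string x ?_ ?_)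
      · exact fun h => hxa (congrArg _ (Fin.ext (h.trans ha.symm)))
      · exact fun h => hxb (congrArg _ (Fin.ext (h.trans hb.symm)))
    · exact Setoid.refl' _ _
  have hpart : ∀ x y z, y ≠ x → z ≠ x → D.conn x y → D.conn x z → y = z := fun x y z h1 h2 h3 h4 =>
    (D.pairing x).unique ⟨h1, h3⟩ ⟨h2, h4⟩
  have hne : (Sum.inl b : Fin m ⊕ Fin n) ≠ .inl a := fun h => by
    have := Sum.inl.inj h
    omega
  refine eq_of_conn_le fun x y hxy => ?_
  by_cases hyx : y = x
  · rw [hyx]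
  by_cases hxa : x = .inl a
  · subst hxa
    obtain rfl := hpart _ _ _ hyx hne hxy hab
    exact hcap
  by_cases hxb : x = .inl b
  · subst hxb
    obtain rfl := hpart _ _ _ hyx hne.symm hxy (D.conn.symm hab)
    exact Setoid.symm' _ hcap
  have hya : y ≠ .inl a := fun h => by
    subst h
    exact hxb (hpart _ _ _ (Ne.symm hyx) hne (D.conn.symm hxy) hab)
  have hyb : y ≠ .inl b := fun h => by
    subst h
    exact hxa (hpart _ _ _ (Ne.symm hyx) hne.symm (D.conn.symm hxy) (D.conn.symm hab))
  exact Setoid.trans' G (hcont x hxa hxb) (Setoid.trans' G (glue_upper E.conn D.conn hxy)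
    (Setoid.symm' G (hcont y hya hyb)))

/-- A diagram with a cup at position `i` absorbs a hook at that position stacked above it. -/
theorem IsHook.eq_comp {m n i : ℕ} {E : Diagram n n} (hE : IsHook i E) {D : Diagram m n}
    (hD : ∀ a b : Fin n, a.val = i → b.val = i + 1 → D.conn (.inr a) (.inr b))
    (hi : i + 2 ≤ n) : D.comp E = D := by
  symm
  obtain ⟨a, ha⟩ : ∃ a : Fin n, a.val = i := ⟨⟨i, by omega⟩, rfl⟩
  obtain ⟨b, hb⟩ : ∃ b : Fin n, b.val = i + 1 := ⟨⟨i + 1, by omega⟩, rfl⟩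
  have hab := hD a b ha hb
  set G := glue D.conn E.conn with hG
  have hcup : G (.inr (.inr a)) (.inr (.inr b)) := glue_upper D.conn E.conn (hE.cup a b ha hb)
  have hcont : ∀ x : Fin m ⊕ Fin n, x ≠ .inr a → x ≠ .inr b →
      G (Sum.map _root_.id Sum.inr x) (Sum.map _root_.id Sum.inl x) := by
    rintro (x | x) hxa hxb
    · exact Setoid.refl' _ _
    · refine Setoid.symm' _
        (glue_upper D.conn E.conn (x := .inl x) (y := .inr x) (hE.string x ?_ ?_))
      · exact fun h => hxa (congrArg _ (Fin.ext (h.trans ha.symm)))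
      · exact fun h => hxb (congrArg _ (Fin.ext (h.trans hb.symm)))
  have hpart : ∀ x y z, y ≠ x → z ≠ x → D.conn x y → D.conn x z → y = z := fun x y z h1 h2 h3 h4 =>
    (D.pairing x).unique ⟨h1, h3⟩ ⟨h2, h4⟩
  have hne : (Sum.inr b : Fin m ⊕ Fin n) ≠ .inr a := fun h => by
    have := Sum.inr.inj h
    omega
  refine eq_of_conn_le fun x y hxy => ?_
  by_cases hyx : y = x
  · rw [hyx]
  by_cases hxa : x = .inr a
  · subst hxa
    obtain rfl := hpart _ _ _ hyx hne hxy hab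
    exact hcup
  by_cases hxb : x = .inr b
  · subst hxb
    obtain rfl := hpart _ _ _ hyx hne.symm hxy (D.conn.symm hab)
    exact Setoid.symm' _ hcup
  have hya : y ≠ .inr a := fun h => by
    subst h
    exact hxb (hpart _ _ _ (Ne.symm hyx) hne (D.conn.symm hxy) hab)
  have hyb : y ≠ .inr b := fun h => by
    subst h
    exact hxa (hpart _ _ _ (Ne.symm hyx) hne.symm (D.conn.symm hxy) (D.conn.symm hab))
  exact Setoid.trans' G (hcont x hxa hxb) (Setoid.trans' G (glue_lower D.conn E.conn hxy)
    (Setoid.symm' G (hcont y hya hyb)))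

theorem IsHook.unique {n i : ℕ} {E F : Diagram n n} (hE : IsHook i E) (hF : IsHook i F)
    (hi : i + 2 ≤ n) : E = F :=
  (hF.eq_comp hE.cup hi).symm.trans (hE.comp_eq hF.cap hi)

theorem IsHook.loops_self {n i : ℕ} {E : Diagram n n} (hE : IsHook i E) (hi : i + 2 ≤ n) :
    E.loops E = 1 := by
  obtain ⟨a, ha⟩ : ∃ a : Fin n, a.val = i := ⟨⟨i, by omega⟩, rfl⟩
  obtain ⟨b, hb⟩ : ∃ b : Fin n, b.val = i + 1 := ⟨⟨i + 1, by omega⟩, rfl⟩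
  have hab : a ≠ b := fun h => by omega
  have hcap := hE.cap a b ha hb
  have hcup := hE.cup a b ha hb
  set G := glue E.conn E.conn with hG
  -- the two middle points at the hook are joined to nothing else
  let M : Fin n ⊕ Fin n ⊕ Fin n → Prop := fun z => z = .inr (.inl a) ∨ z = .inr (.inl b)
  have hM : G ≤ Setoid.ker M := by
    have part : ∀ {x y z : Fin n ⊕ Fin n}, y ≠ x → E.conn x y → E.conn x z → z = x ∨ z = y :=
      fun {x y z} h1 h2 h3 => or_iff_not_imp_left.2 fun h4 => (E.pairing x).unique ⟨h4, h3⟩ ⟨h1, h2⟩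
    have imp : ∀ {S : Setoid (Fin n ⊕ Fin n)} {P : Fin n ⊕ Fin n → Prop},
        (∀ x y, S x y → P x → P y) → S ≤ Setoid.ker P := fun h x y hxy =>
      propext ⟨h x y hxy, h y x (Setoid.symm' _ hxy)⟩
    rw [hG, glue_le_iff]
    constructor
    · refine imp (P := fun x => M (Sum.map _root_.id Sum.inl x)) fun x y hxy hx => ?_
      have hx' : x = .inr a ∨ x = .inr b := by
        rcases x with x | x
        · simp [M] at hx
        · simpa [M] using hx
      have : y = .inr a ∨ y = .inr b := by
        rcases hx' with rfl | rfl
        · exact part (by simpa using hab.symm) hcup hxy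
        · exact (part (by simpa using hab) (E.conn.symm hcup) hxy).symm
      rcases this with rfl | rfl
      · exact .inl rfl
      · exact .inr rfl
    · refine imp (P := fun x => M (Sum.inr x)) fun x y hxy hx => ?_
      have hx' : x = .inl a ∨ x = .inl b := by
        rcases x with x | x
        · simpa [M] using hx
        · simp [M] at hx
      have : y = .inl a ∨ y = .inl b := by
        rcases hx' with rfl | rfl
        · exact part (by simpa using hab.symm) hcap hxy
        · exact (part (by simpa using hab) (E.conn.symm hcap) hxy).symm
      rcases this with rfl | rfl
      · exact .inl rfl
      · exact .inr rfl
  have hGab : G (.inr (.inl a)) (.inr (.inl b)) := glue_upper E.conn E.conn hcap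
  rw [loops, loopCount, Nat.card_eq_one_iff_exists]
  refine ⟨⟨Quotient.mk G (.inr (.inl a)), ?_⟩, ?_⟩
  · intro z hz h
    have h' : M z = M (.inr (.inl a)) := hM (Quotient.exact h)
    have : M z := h' ▸ Or.inl rfl
    rcases this with rfl | rfl <;> exact hz
  · rintro ⟨⟨x | x | x⟩, hx⟩
    · exact absurd rfl (hx (.inl x) trivial)
    · refine Subtype.ext (Quotient.sound ?_)
      by_cases hxa : x = a
      · rw [hxa]
      by_cases hxb : x = b
      · rw [hxb]
        exact Setoid.symm' _ hGab
      · refine absurd (Quotient.sound ?_) (hx (.inl x) trivial)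
        exact glue_lower E.conn E.conn (x := .inl x) (y := .inr x)
          (hE.string x (fun h => hxa (Fin.ext (h.trans ha.symm)))
            fun h => hxb (Fin.ext (h.trans hb.symm)))
    · exact absurd rfl (hx (.inr (.inr x)) trivial)


section adjacent

variable {n i : ℕ} {E F : Diagram n n}

/-- Arcs of `E.comp F` for the adjacent hooks `E` and `F` at the positions `i + 1` and `i`. -/
theorem IsHook.comp_conn_of_adjacent (hE : IsHook (i + 1) E) (hF : IsHook i F) {a b c : Fin n}
    (ha : a.val = i) (hb : b.val = i + 1) (hc : c.val = i + 2) :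
    (E.comp F).conn (.inl b) (.inl c) ∧ (E.comp F).conn (.inl a) (.inr c) ∧
      (E.comp F).conn (.inr a) (.inr b) ∧
      ∀ j : Fin n, j ≠ a → j ≠ b → j ≠ c → (E.comp F).conn (.inl j) (.inr j) := by
  set G := glue E.conn F.conn
  have lower : ∀ {x y}, E.conn x y → G _ _ := glue_lower E.conn F.conn
  have upper : ∀ {x y}, F.conn x y → G _ _ := glue_upper E.conn F.conn
  refine ⟨lower (hE.cap b c hb hc), ?_, upper (hF.cup a b ha hb), fun j hja hjb hjc => ?_⟩
  · exact Setoid.trans' G (lower (hE.string a (by omega) (by omega)))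
      (Setoid.trans' G (upper (hF.cap a b ha hb)) (Setoid.trans' G (lower (hE.cup b c hb hc))
        (upper (hF.string c (by omega) (by omega)))))
  · exact Setoid.trans' G (lower (hE.string j (by omega) (by omega)))
      (upper (hF.string j (by omega) (by omega)))

/-- The Temperley-Lieb relation between adjacent generators; that no loop arises is
`IsHook.loops_of_adjacent` and `IsHook.loops_comp_of_adjacent`. -/
theorem IsHook.comp_comp_of_adjacent (hE : IsHook (i + 1) E) (hF : IsHook i F)
    (hi : i + 3 ≤ n) : (E.comp F).comp E = E := by
  obtain ⟨a, ha⟩ : ∃ a : Fin n, a.val = i := ⟨⟨i, by omega⟩, rfl⟩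
  obtain ⟨b, hb⟩ : ∃ b : Fin n, b.val = i + 1 := ⟨⟨i + 1, by omega⟩, rfl⟩
  obtain ⟨c, hc⟩ : ∃ c : Fin n, c.val = i + 2 := ⟨⟨i + 2, by omega⟩, rfl⟩
  obtain ⟨h1, h2, h3, h4⟩ := hE.comp_conn_of_adjacent hF ha hb hc
  set G := glue (E.comp F).conn E.conn
  have lower : ∀ {x y}, (E.comp F).conn x y → G _ _ := glue_lower (E.comp F).conn E.conn
  have upper : ∀ {x y}, E.conn x y → G _ _ := glue_upper (E.comp F).conn E.conn
  refine IsHook.unique (i := i + 1) (F := E) ⟨fun x y hx hy => by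
      obtain rfl : x = b := Fin.ext (hx.trans hb.symm)
      obtain rfl : y = c := Fin.ext (hy.trans hc.symm)
      exact lower h1, fun x y hx hy => upper (hE.cup x y hx hy), fun j hjb hjc => by
      by_cases hja : j = a
      · subst hja
        exact Setoid.trans' G (lower h2) (Setoid.trans' G
          (Setoid.symm' G (upper (hE.cap b c hb hc))) (Setoid.trans' G
            (Setoid.symm' G (lower h3)) (upper (hE.string j hjb hjc))))
      · exact Setoid.trans' G (lower (h4 j hja (by omega) (by omega)))
          (upper (hE.string j hjb hjc))⟩ hE hi

theorem IsHook.loops_of_adjacent (hE : IsHook (i + 1) E) (hF : IsHook i F)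
    (hi : i + 3 ≤ n) : E.loops F = 0 := by
  obtain ⟨a, ha⟩ : ∃ a : Fin n, a.val = i := ⟨⟨i, by omega⟩, rfl⟩
  obtain ⟨b, hb⟩ : ∃ b : Fin n, b.val = i + 1 := ⟨⟨i + 1, by omega⟩, rfl⟩
  have lower : ∀ {x y}, E.conn x y → glue E.conn F.conn _ _ := glue_lower E.conn F.conn
  have upper : ∀ {x y}, F.conn x y → glue E.conn F.conn _ _ := glue_upper E.conn F.conn
  refine loopCount_eq_zero _ _ fun j => ?_
  by_cases hjb : j = b
  · subst hjb
    exact ⟨.inl a, trivial, Setoid.trans' _ (lower (hE.string a (by omega) (by omega)))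
      (upper (hF.cap a j ha hb))⟩
  · by_cases hjc : j.val = i + 1 + 1
    · exact ⟨.inr (.inr j), trivial,
        Setoid.symm' _ (upper (hF.string j (by omega) (by omega)))⟩
    · exact ⟨.inl j, trivial, lower (hE.string j (by omega) hjc)⟩

theorem IsHook.loops_comp_of_adjacent (hE : IsHook (i + 1) E) (hF : IsHook i F)
    (hi : i + 3 ≤ n) : (E.comp F).loops E = 0 := by
  obtain ⟨a, ha⟩ : ∃ a : Fin n, a.val = i := ⟨⟨i, by omega⟩, rfl⟩
  obtain ⟨b, hb⟩ : ∃ b : Fin n, b.val = i + 1 := ⟨⟨i + 1, by omega⟩, rfl⟩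
  obtain ⟨c, hc⟩ : ∃ c : Fin n, c.val = i + 2 := ⟨⟨i + 2, by omega⟩, rfl⟩
  obtain ⟨-, h2, h3, -⟩ := hE.comp_conn_of_adjacent hF ha hb hc
  set G := glue (E.comp F).conn E.conn
  have lower : ∀ {x y}, (E.comp F).conn x y → G _ _ := glue_lower (E.comp F).conn E.conn
  have upper : ∀ {x y}, E.conn x y → G _ _ := glue_upper (E.comp F).conn E.conn
  refine loopCount_eq_zero _ _ fun j => ?_
  by_cases hjb : j = b
  · subst hjb
    exact ⟨.inr (.inr a), trivial, Setoid.trans' G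
      (Setoid.symm' G (upper (hE.string a (by omega) (by omega)))) (lower h3)⟩
  · by_cases hjc : j = c
    · subst hjc
      exact ⟨.inl a, trivial, lower h2⟩
    · exact ⟨.inr (.inr j), trivial,
        Setoid.symm' G (upper (hE.string j (by omega) (by omega)))⟩

end adjacent

end Diagram

/-! ### Diagrams without turnbacks -/

theorem IsNonCrossing.flip {X : Type} {lt : X → X → Prop} {r : Setoid X}
    (h : IsNonCrossing lt r) : IsNonCrossing (fun x y => lt y x) r :=
  fun x y z w hxy hyz hzw hxz hyw => h w z y x hzw hyz hxy (r.symm hyw) (r.symm hxz)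

/-- An innermost arc of a non-crossing perfect matching joins two neighbours: if the points `v i`
form an interval of the line and no arc joins `v i` to `v (i + 1)`, then no arc joins any two of
these points. -/
theorem not_conn_of_not_conn_succ {X : Type} {lt : X → X → Prop} {r : Setoid X}
    (hp : IsPairing r) (hn : IsNonCrossing lt r) (htri : ∀ x y, lt x y ∨ x = y ∨ lt y x) {n : ℕ}
    (v : Fin n → X) (hv : ∀ i j, lt (v i) (v j) ↔ i < j)
    (hconv : ∀ i j y, lt (v i) y → lt y (v j) → ∃ k, y = v k)
    (h : ∀ i j : Fin n, j.val = i.val + 1 → ¬ r (v i) (v j)) (i j : Fin n) (hij : i < j) :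
    ¬ r (v i) (v j) := by
  obtain ⟨d, hd⟩ : ∃ d, j.val = i.val + 1 + d := ⟨j.val - (i.val + 1), by omega⟩
  induction d using Nat.strong_induction_on generalizing i j with
  | _ d ih =>
    rcases Nat.eq_zero_or_pos d with rfl | hpos
    · exact h i j (by omega)
    intro hr
    obtain ⟨k, hk⟩ : ∃ k : Fin n, k.val = i.val + 1 := ⟨⟨i.val + 1, by omega⟩, rfl⟩
    have hik : i < k := by omega
    have hkj : k < j := by omega
    have hrik := h i k hk
    -- the partner of `v k` is confined to the points enclosed by the arc from `v i` to `v j`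
    obtain ⟨y, ⟨hy, hky⟩, -⟩ := hp (v k)
    rcases htri y (v i) with h1 | rfl | h1
    · exact hn y (v i) (v k) (v j) h1 ((hv _ _).2 hik) ((hv _ _).2 hkj) (r.symm hky) hr
    · exact hrik (r.symm hky)
    rcases htri y (v j) with h2 | rfl | h2
    · obtain ⟨l, rfl⟩ := hconv _ _ _ h1 h2
      have hil := (hv _ _).1 h1
      have hlj := (hv _ _).1 h2
      have hlk : l.val ≠ k.val := fun h => hy (by rw [Fin.ext h])
      exact ih (l.val - (k.val + 1)) (by omega) k l (by omega) (by omega) hky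
    · exact hrik (r.trans hr (r.symm hky))
    · exact hn (v i) (v k) (v j) y ((hv _ _).2 hik) ((hv _ _).2 hkj) h2 hr hky

theorem before_trichotomy {m n : ℕ} (x y : Fin m ⊕ Fin n) : Before x y ∨ x = y ∨ Before y x := by
  rcases x with x | x <;> rcases y with y | y <;> simp [Before] <;> omega

namespace Diagram

variable {m n : ℕ} (D : Diagram m n)

/-- Without turnbacks every bottom point is joined to a top point, and planarity makes this
correspondence monotone. -/
theorem exists_orderIso_of_no_turnback
    (hcap : ∀ a b : Fin m, b.val = a.val + 1 → ¬ D.conn (.inl a) (.inl b))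
    (hcup : ∀ a b : Fin n, b.val = a.val + 1 → ¬ D.conn (.inr a) (.inr b)) :
    ∃ f : Fin m ≃o Fin n, ∀ i, D.conn (.inl i) (.inr (f i)) := by
  have hcap' : ∀ i j : Fin m, i ≠ j → ¬ D.conn (.inl i) (.inl j) := by
    have key := not_conn_of_not_conn_succ D.pairing D.planar before_trichotomy Sum.inl
      (by simp [Before]) (by rintro i j (y | y) <;> simp [Before]) hcap
    intro i j hij h
    rcases lt_or_gt_of_ne hij with h' | h'
    · exact key i j h' h
    · exact key j i h' (D.conn.symm h)
  have hcup' : ∀ i j : Fin n, i ≠ j → ¬ D.conn (.inr i) (.inr j) := by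
    have key := not_conn_of_not_conn_succ D.pairing D.planar.flip
      (fun x y => before_trichotomy y x |>.imp_right (Or.imp_left Eq.symm)) Sum.inr
      (by simp [Before]) (by rintro i j (y | y) <;> simp [Before]) hcup
    intro i j hij h
    rcases lt_or_gt_of_ne hij with h' | h'
    · exact key i j h' h
    · exact key j i h' (D.conn.symm h)
  have hf : ∀ i : Fin m, ∃ j, D.conn (.inl i) (.inr j) := fun i => by
    obtain ⟨y | y, ⟨h1, h2⟩, -⟩ := D.pairing (.inl i)
    · exact absurd h2 (hcap' i y fun h => h1 (by rw [h]))
    · exact ⟨y, h2⟩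
  have hg : ∀ j : Fin n, ∃ i, D.conn (.inl i) (.inr j) := fun j => by
    obtain ⟨y | y, ⟨h1, h2⟩, -⟩ := D.pairing (.inr j)
    · exact ⟨y, D.conn.symm h2⟩
    · exact absurd h2 (hcup' j y fun h => h1 (by rw [h]))
  choose f hf using hf
  have hinj : ∀ i i' j, D.conn (.inl i) (.inr j) → D.conn (.inl i') (.inr j) → i = i' :=
    fun i i' j h h' => by_contra fun hne => hcap' i i' hne (D.conn.trans h (D.conn.symm h'))
  have hmono : StrictMono f := by
    intro i j hij
    rcases lt_trichotomy (f i) (f j) with h | h | h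
    · exact h
    · exact absurd (hinj i j (f i) (hf i) (h ▸ hf j)) hij.ne
    · exact absurd (hf j) (D.planar (.inl i) (.inl j) (.inr (f i)) (.inr (f j))
        (by simpa [Before] using hij) (by simp [Before]) (by simpa [Before] using h) (hf i))
  have hsurj : Function.Surjective f := fun j => by
    obtain ⟨i, hi⟩ := hg j
    exact ⟨i, by_contra fun hne => hcup' _ _ hne (D.conn.trans (D.conn.symm (hf i)) hi)⟩
  exact ⟨hmono.orderIsoOfSurjective f hsurj, hf⟩

theorem exists_turnback_of_ne (hmn : m ≠ n) :
    (∃ a b : Fin m, b.val = a.val + 1 ∧ D.conn (.inl a) (.inl b)) ∨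
      ∃ a b : Fin n, b.val = a.val + 1 ∧ D.conn (.inr a) (.inr b) := by
  by_contra! h
  obtain ⟨f, -⟩ := D.exists_orderIso_of_no_turnback h.1 h.2
  exact hmn (by simpa using Fintype.card_congr f.toEquiv)

theorem exists_turnback_of_ne_id (D : Diagram n n) (hD : D ≠ id n) :
    (∃ a b : Fin n, b.val = a.val + 1 ∧ D.conn (.inl a) (.inl b)) ∨
      ∃ a b : Fin n, b.val = a.val + 1 ∧ D.conn (.inr a) (.inr b) := by
  by_contra! h
  obtain ⟨f, hf⟩ := D.exists_orderIso_of_no_turnback h.1 h.2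
  obtain rfl : f = OrderIso.refl _ := Subsingleton.elim _ _
  refine hD (eq_of_conn_le fun x y hxy => ?_).symm
  rcases x with x | x <;> rcases y with y | y <;> obtain rfl : x = y := hxy
  · exact Setoid.refl' _ _
  · exact hf x
  · exact Setoid.symm' _ (hf x)
  · exact Setoid.refl' _ _

end Diagram

/-! ### Quantum integers -/

theorem q_ne_zero : q ≠ 0 := RatFunc.X_ne_zero

theorem q_pow_ne_one {n : ℕ} (hn : n ≠ 0) : q ^ n ≠ 1 := by
  intro h
  have h' : algebraMap (Polynomial ℂ) K (Polynomial.X ^ n) = algebraMap (Polynomial ℂ) K 1 := by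
    rw [map_pow, RatFunc.algebraMap_X, map_one]
    exact h
  have := congrArg Polynomial.natDegree (RatFunc.algebraMap_injective ℂ h')
  simp [hn] at this

theorem q_sub_inv_ne_zero : q - q⁻¹ ≠ 0 := by
  intro h
  refine q_pow_ne_one two_ne_zero ?_
  have := q_ne_zero
  field_simp at h
  linear_combination h

theorem quantumInt_ne_zero {n : ℕ} (hn : n ≠ 0) : quantumInt n ≠ 0 := by
  refine div_ne_zero (fun h => ?_) q_sub_inv_ne_zero
  refine q_pow_ne_one (n := 2 * n) (by omega) ?_
  have := pow_ne_zero n q_ne_zero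
  rw [zpow_neg, zpow_natCast] at h
  field_simp at h
  rw [mul_comm, pow_mul]
  linear_combination h

theorem quantumInt_one : quantumInt 1 = 1 := by
  rw [quantumInt]
  simpa using div_self q_sub_inv_ne_zero

theorem loopVar_mul_quantumInt (n : ℕ) :
    loopVar * quantumInt (n + 1) = quantumInt (n + 2) + quantumInt n := by
  have h1 := q_ne_zero
  have h2 := q_sub_inv_ne_zero
  simp only [quantumInt, loopVar, zpow_neg, zpow_natCast]
  rw [← add_div, mul_div_assoc']
  congr 1
  field_simp
  ring

theorem quantumInt_zero : quantumInt 0 = 0 := by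
  simp [quantumInt]

theorem quantumInt_two : quantumInt 2 = loopVar := by
  simpa [quantumInt_one, quantumInt_zero] using (loopVar_mul_quantumInt 0).symm

theorem loopVar_ne_zero : loopVar ≠ 0 :=
  quantumInt_two ▸ quantumInt_ne_zero two_ne_zero

/-! ### Wenzl's recursion in an abstract algebra -/

section wenzl

variable {R A : Type*} [Field R] [Ring A] [Algebra R A] {p r u e : A} {b c d : R}

/-- One step of Wenzl's recursion: `p` and `r` play the roles of the idempotents on one and on two
strands less, `u` that of the last generator. -/
theorem wenzl_step (hcb : c * b = 1) (hpp : p * p = p) (hpr : p * r = p) (hrp : r * p = p)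
    (hru : r * u = u * r) (hupu : u * p * u = b • (r * u)) {p' : A}
    (hp' : p' = p - c • (p * u * p)) :
    p' * p' = p' ∧ p' * p = p' ∧ p * p' = p' ∧ p' * u = 0 ∧ u * p' = 0 := by
  have h1 : p' * p = p' := by
    rw [hp', sub_mul, smul_mul_assoc, mul_assoc _ p p, hpp]
  have h2 : p * p' = p' := by
    rw [hp', mul_sub, mul_smul_comm, ← mul_assoc p, ← mul_assoc p, hpp]
  have h3 : p' * u = 0 := by
    rw [hp', sub_mul, smul_mul_assoc, mul_assoc _ p u, mul_assoc p u, ← mul_assoc u, hupu,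
      mul_smul_comm, smul_smul, hcb, one_smul, ← mul_assoc, hpr, sub_self]
  have h4 : u * p' = 0 := by
    rw [hp', mul_sub, mul_smul_comm, ← mul_assoc, ← mul_assoc, hupu, smul_mul_assoc, smul_smul,
      hcb, one_smul, hru, mul_assoc, hrp, sub_self]
  refine ⟨?_, h1, h2, h3, h4⟩
  nth_rewrite 1 [hp']
  rw [sub_mul, h2, smul_mul_assoc, mul_assoc (p * u), h2, mul_assoc, h4, mul_zero, smul_zero,
    sub_zero]

/-- The partial trace of a Jones-Wenzl idempotent, in the form of a relation between consecutive
generators `e` and `u`. -/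
theorem wenzl_partial_trace (hrr : r * r = r) (hru : r * u = u * r) (huu : u * u = d • u)
    (hueu : u * e * u = u) (hp : p = r - c • (r * e * r)) :
    u * p * u = (d - c) • (r * u) := by
  have h1 : u * r * u = d • (r * u) := by
    rw [← hru, mul_assoc, huu, mul_smul_comm]
  have h2 : u * (r * e * r) * u = r * u := by
    calc u * (r * e * r) * u = (u * r) * e * (r * u) := by simp only [mul_assoc]
      _ = (r * u) * e * (u * r) := congrArg₂ (· * e * ·) hru.symm hru
      _ = r * (u * e * u) * r := by simp only [mul_assoc]
      _ = r * u := by rw [hueu, mul_assoc, ← hru, ← mul_assoc, hrr]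
  rw [hp, mul_sub, sub_mul, mul_smul_comm, smul_mul_assoc, h1, h2, sub_smul]

end wenzl

section category

variable {R C : Type*} [Field R] [Category C] [Preadditive C] [Linear R C] {X : C}
  {p r u e : X ⟶ X} {b c d : R}

/-- `wenzl_step` for endomorphisms. The product of `End X` is composition in the reverse order, so
the left and the right version of each hypothesis and conclusion trade places. -/
theorem comp_wenzl_step (hcb : c * b = 1) (hpp : p ≫ p = p) (hpr : p ≫ r = p) (hrp : r ≫ p = p)
    (hru : r ≫ u = u ≫ r) (hupu : u ≫ p ≫ u = b • (r ≫ u)) {p' : X ⟶ X}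
    (hp' : p' = p - c • (p ≫ u ≫ p)) :
    p' ≫ p' = p' ∧ p ≫ p' = p' ∧ p' ≫ p = p' ∧ u ≫ p' = 0 ∧ p' ≫ u = 0 :=
  wenzl_step (A := End X) hcb hpp hrp hpr hru.symm (hupu.trans (by rw [hru]; rfl)) hp'

theorem comp_wenzl_partial_trace (hrr : r ≫ r = r) (hru : r ≫ u = u ≫ r) (huu : u ≫ u = d • u)
    (hueu : u ≫ e ≫ u = u) (hp : p = r - c • (r ≫ e ≫ r)) :
    u ≫ p ≫ u = (d - c) • (r ≫ u) :=
  (wenzl_partial_trace (A := End X) hrr hru.symm huu hueu hp).trans (by rw [hru]; rfl)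

end category

/-! ### Morphisms of the Temperley-Lieb category -/

/-- A diagram as a morphism of the Temperley-Lieb category. -/
noncomputable def diagramHom {m n : ℕ} (D : Diagram m n) : (⟨m⟩ : TL) ⟶ ⟨n⟩ := ofDiagram D

theorem diagramHom_comp {m n k : ℕ} (D : Diagram m n) (E : Diagram n k) :
    diagramHom D ≫ diagramHom E = loopVar ^ D.loops E • diagramHom (D.comp E) :=
  compose_ofDiagram D E

theorem diagramHom_id (n : ℕ) : diagramHom (Diagram.id n) = 𝟙 (⟨n⟩ : TL) := rfl

@[elab_as_elim]
theorem hom_induction {m n : ℕ} {P : ((⟨m⟩ : TL) ⟶ ⟨n⟩) → Prop} (f : (⟨m⟩ : TL) ⟶ ⟨n⟩)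
    (zero : P 0) (add : ∀ f g, P f → P g → P (f + g))
    (smul : ∀ (c : K) (D : Diagram m n), P (c • diagramHom D)) : P f := by
  refine Finsupp.induction_linear f zero add fun D c => ?_
  have h : Finsupp.single D c = c • ofDiagram D := by simp [ofDiagram]
  rw [h]
  exact smul c D

/-- Placing one vertical string to the right of an endomorphism. -/
noncomputable def addStrand (n : ℕ) :
    ((⟨n⟩ : TL) ⟶ ⟨n⟩) →ₗ[K] ((⟨n + 1⟩ : TL) ⟶ ⟨n + 1⟩) :=
  Finsupp.linearCombination K
    fun D : Diagram n n => diagramHom (D.tensor (Diagram.id 1))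

theorem addStrand_diagramHom {n : ℕ} (D : Diagram n n) :
    addStrand n (diagramHom D) = diagramHom (D.tensor (Diagram.id 1)) := by
  refine (Finsupp.linearCombination_single K (1 : K) D).trans (one_smul K _)

theorem tensor_ofDiagram {m n m' n' : ℕ} (D : Diagram m n) (E : Diagram m' n') :
    tensor (ofDiagram D) (ofDiagram E) = ofDiagram (D.tensor E) := by
  simp [tensor, ofDiagram]

theorem tensor_id_one_eq_addStrand {n : ℕ} (f : (⟨n⟩ : TL) ⟶ ⟨n⟩) :
    tensor (m := n) (n := n) f (ofDiagram (Diagram.id 1)) = addStrand n f := by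
  let φ : FormalDiagram n n →ₗ[K] FormalDiagram (n + 1) (n + 1) :=
    (Finsupp.linearCombination K fun a : Diagram n n =>
      Finsupp.linearCombination K fun b : Diagram 1 1 => ofDiagram (a.tensor b)).flip
        (ofDiagram (Diagram.id 1))
  change φ f = addStrand n f
  induction f using hom_induction with
  | zero => exact (map_zero φ).trans (map_zero (addStrand n)).symm
  | add f g hf hg =>
    exact ((map_add φ f g).trans (congrArg₂ _ hf hg)).trans (map_add (addStrand n) f g).symm
  | smul c D =>
    rw [map_smul (addStrand n), addStrand_diagramHom]
    exact (map_smul φ c (ofDiagram D)).trans (congrArg (c • ·) (tensor_ofDiagram D _))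

theorem addStrand_comp {n : ℕ} (f g : (⟨n⟩ : TL) ⟶ ⟨n⟩) :
    addStrand n (f ≫ g) = addStrand n f ≫ addStrand n g := by
  induction f using hom_induction with
  | zero => simp only [Limits.zero_comp, map_zero]
  | add f f' hf hf' => rw [Preadditive.add_comp, map_add, map_add, Preadditive.add_comp, hf, hf']
  | smul c D =>
  induction g using hom_induction with
  | zero => simp only [Limits.comp_zero, map_zero]
  | add g g' hg hg' => rw [Preadditive.comp_add, map_add, map_add, Preadditive.comp_add, hg, hg']
  | smul c' E =>
  have h : (Diagram.id 1).comp (Diagram.id 1) = Diagram.id 1 := Diagram.id_comp _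
  simp only [Linear.smul_comp, Linear.comp_smul, map_smul, diagramHom_comp, addStrand_diagramHom,
    Diagram.tensor_comp_tensor, Diagram.loops_tensor, Diagram.loops_id_left, add_zero, h]

theorem addStrand_id (n : ℕ) : addStrand n (𝟙 _) = 𝟙 _ := by
  rw [← diagramHom_id, addStrand_diagramHom, Diagram.id_tensor_id, diagramHom_id]

/-- The last generator of the Temperley-Lieb algebra on `n + 2` strands. -/
noncomputable def lastHook (n : ℕ) : (⟨n + 2⟩ : TL) ⟶ ⟨n + 2⟩ :=
  diagramHom ((Diagram.id n).tensor (Diagram.cap.comp Diagram.cup))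

theorem lastHook_comp_self (n : ℕ) : lastHook n ≫ lastHook n = loopVar • lastHook n := by
  have h := Diagram.isHook_id_tensor_cap_comp_cup n
  rw [lastHook, diagramHom_comp, h.loops_self le_rfl, h.comp_eq h.cap le_rfl, pow_one]

theorem lastHook_comp_addStrand_comp (n : ℕ) :
    lastHook (n + 1) ≫ addStrand (n + 2) (lastHook n) ≫ lastHook (n + 1) = lastHook (n + 1) := by
  have hE := Diagram.isHook_id_tensor_cap_comp_cup (n + 1)
  have hF := (Diagram.isHook_id_tensor_cap_comp_cup n).tensor_id_one le_rfl
  rw [← Category.assoc, lastHook, lastHook, addStrand_diagramHom, diagramHom_comp,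
    Linear.smul_comp, diagramHom_comp, hE.loops_of_adjacent hF le_rfl,
    hE.loops_comp_of_adjacent hF le_rfl, hE.comp_comp_of_adjacent hF le_rfl, pow_zero, one_smul,
    one_smul]

theorem addStrand_addStrand_comp_lastHook (n : ℕ) (f : (⟨n⟩ : TL) ⟶ ⟨n⟩) :
    addStrand (n + 1) (addStrand n f) ≫ lastHook n =
      lastHook n ≫ addStrand (n + 1) (addStrand n f) := by
  induction f using hom_induction with
  | zero => simp only [map_zero, Limits.zero_comp, Limits.comp_zero]
  | add f f' hf hf' => simp only [map_add, Preadditive.add_comp, Preadditive.comp_add, hf, hf']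
  | smul c D =>
  simp only [map_smul, Linear.smul_comp, Linear.comp_smul, addStrand_diagramHom]
  rw [Diagram.tensor_id_one_tensor_id_one, lastHook]
  congr 1
  refine (diagramHom_comp _ _).trans (Eq.trans ?_ (diagramHom_comp _ _).symm)
  rw [Diagram.tensor_comp_tensor, Diagram.tensor_comp_tensor, Diagram.loops_tensor,
    Diagram.loops_tensor, Diagram.id_comp, Diagram.comp_id, Diagram.id_comp, Diagram.comp_id,
    Diagram.loops_id_left, Diagram.loops_id_left, Diagram.loops_id_right, Diagram.loops_id_right]

/-! ### The Jones-Wenzl idempotents -/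

/-- The recursion of `jonesWenzl` in terms of `addStrand` and `lastHook`. -/
theorem jonesWenzl_add_two (n : ℕ) :
    jonesWenzl (n + 2) = addStrand (n + 1) (jonesWenzl (n + 1)) -
      (quantumInt (n + 1) / quantumInt (n + 2)) •
        (addStrand (n + 1) (jonesWenzl (n + 1)) ≫ lastHook n ≫
          addStrand (n + 1) (jonesWenzl (n + 1))) := by
  have hu : lastHook n = tensor (ofDiagram (Diagram.id n))
      (compose 2 0 2 (ofDiagram Diagram.cap) (ofDiagram Diagram.cup)) := by
    have hloops : Diagram.cap.loops Diagram.cup = 0 := loopCount_eq_zero _ _ fun b => b.elim0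
    rw [compose_ofDiagram, hloops, pow_zero, one_smul]
    exact (tensor_ofDiagram _ _).symm
  rw [← tensor_id_one_eq_addStrand, hu]
  rfl

/-- The invariants that are propagated together along Wenzl's recursion. Apart from idempotency and
absorption, `partial_trace` is the formula that determines the coefficient in the definition of
`jonesWenzl (n + 2)`. -/
structure IsWenzl (n : ℕ) : Prop where
  idem : jonesWenzl n ≫ jonesWenzl n = jonesWenzl n
  idem_succ : jonesWenzl (n + 1) ≫ jonesWenzl (n + 1) = jonesWenzl (n + 1)
  absorb_left : addStrand n (jonesWenzl n) ≫ jonesWenzl (n + 1) = jonesWenzl (n + 1)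
  absorb_right : jonesWenzl (n + 1) ≫ addStrand n (jonesWenzl n) = jonesWenzl (n + 1)
  partial_trace : lastHook n ≫ addStrand (n + 1) (jonesWenzl (n + 1)) ≫ lastHook n =
    (quantumInt (n + 2) / quantumInt (n + 1)) •
      (addStrand (n + 1) (addStrand n (jonesWenzl n)) ≫ lastHook n)

theorem isWenzl_zero : IsWenzl 0 where
  idem := Category.comp_id _
  idem_succ := Category.comp_id _
  absorb_left := by
    rw [jonesWenzl, addStrand_id]
    exact Category.id_comp _
  absorb_right := by
    rw [jonesWenzl, addStrand_id]
    exact Category.comp_id _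
  partial_trace := by
    have h0 : jonesWenzl 0 = 𝟙 _ := rfl
    have h1 : jonesWenzl (0 + 1) = 𝟙 _ := rfl
    have hq : quantumInt (0 + 2) / quantumInt (0 + 1) = loopVar := by
      simp only [zero_add, quantumInt_one, quantumInt_two, div_one]
    rw [h0, h1, addStrand_id, addStrand_id, addStrand_id, hq, Category.id_comp]
    exact lastHook_comp_self 0

theorem IsWenzl.step {n : ℕ} (h : IsWenzl n) :
    jonesWenzl (n + 2) ≫ jonesWenzl (n + 2) = jonesWenzl (n + 2) ∧
      addStrand (n + 1) (jonesWenzl (n + 1)) ≫ jonesWenzl (n + 2) = jonesWenzl (n + 2) ∧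
      jonesWenzl (n + 2) ≫ addStrand (n + 1) (jonesWenzl (n + 1)) = jonesWenzl (n + 2) ∧
      lastHook n ≫ jonesWenzl (n + 2) = 0 ∧ jonesWenzl (n + 2) ≫ lastHook n = 0 := by
  have h1 := quantumInt_ne_zero (Nat.succ_ne_zero n)
  have h2 := quantumInt_ne_zero (Nat.succ_ne_zero (n + 1))
  refine comp_wenzl_step (r := addStrand (n + 1) (addStrand n (jonesWenzl n)))
    (b := quantumInt (n + 2) / quantumInt (n + 1)) (c := quantumInt (n + 1) / quantumInt (n + 2))
    ?_ ?_ ?_ ?_ (addStrand_addStrand_comp_lastHook n _) h.partial_trace (jonesWenzl_add_two n)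
  · exact div_mul_div_cancel₀' h1 _ _ |>.trans (div_self h2)
  · rw [← addStrand_comp, h.idem_succ]
  · rw [← addStrand_comp, h.absorb_right]
  · rw [← addStrand_comp, h.absorb_left]

theorem IsWenzl.succ {n : ℕ} (h : IsWenzl n) : IsWenzl (n + 1) where
  idem := h.idem_succ
  idem_succ := h.step.1
  absorb_left := h.step.2.1
  absorb_right := h.step.2.2.1
  partial_trace := by
    have h2 := quantumInt_ne_zero (Nat.succ_ne_zero (n + 1))
    have hb : quantumInt (n + 1 + 2) / quantumInt (n + 1 + 1) =
        loopVar - quantumInt (n + 1) / quantumInt (n + 2) := by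
      rw [eq_sub_iff_add_eq, ← add_div, div_eq_iff h2]
      exact (loopVar_mul_quantumInt (n + 1)).symm
    rw [hb]
    refine comp_wenzl_partial_trace (e := addStrand (n + 2) (lastHook n)) ?_
      (addStrand_addStrand_comp_lastHook _ _) (lastHook_comp_self _)
      (lastHook_comp_addStrand_comp n) ?_
    · rw [← addStrand_comp, ← addStrand_comp, h.idem_succ]
    · rw [← addStrand_comp, ← addStrand_comp, ← map_smul, ← map_sub]
      exact congrArg _ (jonesWenzl_add_two n)

theorem isWenzl (n : ℕ) : IsWenzl n :=
  Nat.rec isWenzl_zero (fun _ => IsWenzl.succ) n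

theorem jonesWenzl_idem (n : ℕ) : jonesWenzl n ≫ jonesWenzl n = jonesWenzl n :=
  (isWenzl n).idem

/-- A generator at a position that fits into `n` strings already is killed by `jonesWenzl n`, which
is absorbed by `jonesWenzl (n + 1)`; only the last generator needs Wenzl's recursion. -/
theorem exists_isHook_jonesWenzl_comp_eq_zero {n i : ℕ} (hi : i + 2 ≤ n) :
    ∃ E : Diagram n n, E.IsHook i ∧ jonesWenzl n ≫ diagramHom E = 0 ∧
      diagramHom E ≫ jonesWenzl n = 0 := by
  induction n with
  | zero => omega
  | succ n ih =>
    rcases Nat.lt_or_ge n (i + 2) with h | h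
    · obtain rfl : n = i + 1 := by omega
      exact ⟨_, Diagram.isHook_id_tensor_cap_comp_cup i, (isWenzl i).step.2.2.2.2,
        (isWenzl i).step.2.2.2.1⟩
    · obtain ⟨E, hE, h1, h2⟩ := ih h
      refine ⟨_, hE.tensor_id_one h, ?_, ?_⟩
      · rw [← (isWenzl n).absorb_right, Category.assoc, ← addStrand_diagramHom, ← addStrand_comp,
          h1, map_zero, Limits.comp_zero]
      · rw [← (isWenzl n).absorb_left, ← Category.assoc, ← addStrand_diagramHom, ← addStrand_comp,
          h2, map_zero, Limits.zero_comp]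

/-! ### Morphisms between the Jones-Wenzl idempotents -/

/-- If `D` joins two neighbouring bottom points, it differs from its stack on a hook only by a power
of `loopVar`, and hooks are killed by `jonesWenzl m`. -/
theorem jonesWenzl_comp_diagramHom_of_cap {m n : ℕ} {D : Diagram m n} {a b : Fin m}
    (hab : b.val = a.val + 1) (h : D.conn (.inl a) (.inl b)) :
    jonesWenzl m ≫ diagramHom D = 0 := by
  have hi : a.val + 2 ≤ m := by omega
  obtain ⟨E, hE, h1, -⟩ := exists_isHook_jonesWenzl_comp_eq_zero hi
  have hED : E.comp D = D := hE.comp_eq (fun x y hx hy => by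
    rwa [Fin.ext hx, Fin.ext (hy.trans hab.symm)]) hi
  have key : jonesWenzl m ≫ diagramHom E ≫ diagramHom D = 0 := by
    rw [← Category.assoc, h1, Limits.zero_comp]
  rw [diagramHom_comp, hED, Linear.comp_smul] at key
  exact (smul_eq_zero.1 key).resolve_left (pow_ne_zero _ loopVar_ne_zero)

theorem diagramHom_comp_jonesWenzl_of_cup {m n : ℕ} {D : Diagram m n} {a b : Fin n}
    (hab : b.val = a.val + 1) (h : D.conn (.inr a) (.inr b)) :
    diagramHom D ≫ jonesWenzl n = 0 := by
  have hi : a.val + 2 ≤ n := by omega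
  obtain ⟨E, hE, -, h1⟩ := exists_isHook_jonesWenzl_comp_eq_zero hi
  have hDE : D.comp E = D := hE.eq_comp (fun x y hx hy => by
    rwa [Fin.ext hx, Fin.ext (hy.trans hab.symm)]) hi
  have key : (diagramHom D ≫ diagramHom E) ≫ jonesWenzl n = 0 := by
    rw [Category.assoc, h1, Limits.comp_zero]
  rw [diagramHom_comp, hDE, Linear.smul_comp] at key
  exact (smul_eq_zero.1 key).resolve_left (pow_ne_zero _ loopVar_ne_zero)

theorem jonesWenzl_comp_diagramHom_comp_eq_zero {m n : ℕ} {D : Diagram m n}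
    (h : (∃ a b : Fin m, b.val = a.val + 1 ∧ D.conn (.inl a) (.inl b)) ∨
      ∃ a b : Fin n, b.val = a.val + 1 ∧ D.conn (.inr a) (.inr b)) :
    jonesWenzl m ≫ diagramHom D ≫ jonesWenzl n = 0 := by
  rcases h with ⟨a, b, hab, h⟩ | ⟨a, b, hab, h⟩
  · rw [← Category.assoc, jonesWenzl_comp_diagramHom_of_cap hab h, Limits.zero_comp]
  · rw [diagramHom_comp_jonesWenzl_of_cup hab h, Limits.comp_zero]

theorem jonesWenzl_comp_comp_eq_zero {m n : ℕ} (hmn : m ≠ n) (f : (⟨m⟩ : TL) ⟶ ⟨n⟩) :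
    jonesWenzl m ≫ f ≫ jonesWenzl n = 0 := by
  induction f using hom_induction with
  | zero => rw [Limits.zero_comp, Limits.comp_zero]
  | add f g hf hg => rw [Preadditive.add_comp, Preadditive.comp_add, hf, hg, add_zero]
  | smul c D =>
    rw [Linear.smul_comp, Linear.comp_smul,
      jonesWenzl_comp_diagramHom_comp_eq_zero (D.exists_turnback_of_ne hmn), smul_zero]

theorem exists_jonesWenzl_comp_comp_eq_smul {n : ℕ} (f : (⟨n⟩ : TL) ⟶ ⟨n⟩) :
    ∃ c : K, jonesWenzl n ≫ f ≫ jonesWenzl n = c • jonesWenzl n := by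
  induction f using hom_induction with
  | zero => exact ⟨0, by rw [Limits.zero_comp, Limits.comp_zero, zero_smul]⟩
  | add f g hf hg =>
    obtain ⟨a, ha⟩ := hf
    obtain ⟨b, hb⟩ := hg
    exact ⟨a + b, by rw [Preadditive.add_comp, Preadditive.comp_add, ha, hb, add_smul]⟩
  | smul c D =>
    rw [Linear.smul_comp, Linear.comp_smul]
    by_cases hD : D = Diagram.id n
    · refine ⟨c, ?_⟩
      rw [hD, diagramHom_id, Category.id_comp, jonesWenzl_idem]
    · refine ⟨0, ?_⟩
      rw [jonesWenzl_comp_diagramHom_comp_eq_zero (D.exists_turnback_of_ne_id hD), smul_zero,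
        zero_smul]

end TemperleyLieb

open TemperleyLieb
theorem mainTheorem4 :
    ∃ h : ∀ n : ℕ, jonesWenzl n ≫ jonesWenzl n = jonesWenzl n,
      let P : ℕ → Karoubi TL := fun n => ⟨⟨n⟩, jonesWenzl n, h n⟩
      Function.Injective P ∧ IsDisjointSimple K (Set.range P) := by
  refine ⟨jonesWenzl_idem, fun m n h => congrArg (fun Q => Q.X.points) h, ?_, ?_⟩
  · rintro _ ⟨n, rfl⟩
    refine (Submodule.eq_top_iff').2 fun f => Submodule.mem_span_singleton.2 ?_
    obtain ⟨c, hc⟩ := exists_jonesWenzl_comp_comp_eq_smul f.f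
    exact ⟨c, Karoubi.Hom.ext (hc.symm.trans f.comm)⟩
  · rintro _ ⟨m, rfl⟩ _ ⟨n, rfl⟩ hne f
    have hmn : m ≠ n := fun h => hne (by rw [h])
    exact Karoubi.Hom.ext (f.comm.symm.trans (jonesWenzl_comp_comp_eq_zero hmn f.f))
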